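/- Let $Z=(Z_n)_{n\ge 0}$ be an irreducible discrete-time Markov chain on $\mathbb N_0=\{0,1,2,\dots\}$, with arbitrary initial distribution, and let $U=(U(x))_{x\in\mathbb N_0}$ be its step distribution, i.e. $\Pr[Z_{n+1}=y\mid Z_n=x]=\Pr[U(x)=y]$ for all $n\ge 0$ and $x,y\in\mathbb N_0$. Assume that the limit $$\mu=\lim_{x\to\infty}\frac{\mathbb E[U(x)]}{x}$$ exists (in $\mathbb R$), and that there is a constant $c>0$ such that for all sufficiently large $x\in\mathbb N_0$ and for all $\varepsilon>0$, $$\Pr\left[\left|\frac{U(x)}{x}-\mu\right|>\varepsilon\right]\le 2\exp\left(-\frac{c\,\varepsilon^2}{1+\mu+\varepsilon}\,x\right).$$ For $x\ge 1$ put $\rho(x)=\mathbb E[U(x)-\mu x]$, $\nu(x)=\mathbb E[(U(x)-\mu x)^2]/x$ and $\theta(x)=2\rho(x)/\nu(x)$ (only large $x$ matter below). Say that $Z$ *can climb before $0$* if for every $N$ there is an $n$ with $\Pr[Z_n\ge N \text{ and } Z_k>0 \text{ for all } k\le n]>0$ (for example, this holds if $Z_0=1$ and every positive integer is accessible from $1$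 without visiting $0$). 1. If $\mu>1$ and $Z$ can climb before $0$, then $\Pr[Z_n>0\text{ for all }n]>0$. 2. If $\mu<1$, then $\Pr[Z_n=0\text{ for some }n]=1$. 3. Suppose $\mu=1$, and let $\alpha:\mathbb N_0\to\mathbb R$ be such that $\alpha(x)\nu(x)\to+\infty$ as $x\to\infty$. - If $\theta(x)<1+\frac{1}{\ln x}-\alpha(x)x^{-1/2}$ for all sufficiently large $x$, then $\Pr[Z_n=0\text{ for some }n]=1$. - If $\theta(x)>1+\frac{2}{\ln x}+\alpha(x)x^{-1/2}$ for all sufficiently large $x$ and $Z$ can climb before $0$, then $\Pr[Z_n>0\text{ for all }n]>0$. -/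

import Mathlib

open MeasureTheory ProbabilityTheory Filter Topology

/-- `Z` is a discrete-time Markov chain on `ℕ` under the law `P` whose step distribution is `U`,
i.e. `U x` is the law of `U(x)`, and conditionally on `Z 0 = x 0, …, Z n = x n` the law of
`Z (n + 1)` is `U (x n)`. The law of `Z 0` is arbitrary. -/
structure IsMarkovChain {Ω : Type*} [MeasurableSpace Ω] (P : Measure Ω) (U : Kernel ℕ ℕ)
    (Z : ℕ → Ω → ℕ) : Prop where
  measurable : ∀ n, Measurable (Z n)
  markov : ∀ (n : ℕ) (x : ℕ → ℕ),
    P {ω | ∀ k ≤ n + 1, Z k ω = x k} = P {ω | ∀ k ≤ n, Z k ω = x k} * U (x n) {x (n + 1)}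

/-- For every level `N`, the process reaches `[N, ∞)` strictly before visiting `0`
with positive probability. -/
def CanClimbBeforeZero {Ω : Type*} [MeasurableSpace Ω] (P : Measure Ω) (Z : ℕ → Ω → ℕ) : Prop :=
  ∀ N : ℕ, ∃ n : ℕ, 0 < P {ω | N ≤ Z n ω ∧ ∀ k ≤ n, 0 < Z k ω}

/-- The expectation `E[U(x)]`. -/
noncomputable def stepMean (U : Kernel ℕ ℕ) (x : ℕ) : ℝ :=
  ∫ y, (y : ℝ) ∂(U x)

/-- The drift `ρ(x) = E[U(x) - μ x]`. -/
noncomputable def drift (U : Kernel ℕ ℕ) (μ : ℝ) (x : ℕ) : ℝ :=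
  ∫ y, ((y : ℝ) - μ * x) ∂(U x)

/-- The diffusion `ν(x) = E[(U(x) - μ x)²] / x`. -/
noncomputable def diffusion (U : Kernel ℕ ℕ) (μ : ℝ) (x : ℕ) : ℝ :=
  (∫ y, ((y : ℝ) - μ * x) ^ 2 ∂(U x)) / x

/-- The ratio `θ(x) = 2 ρ(x) / ν(x)`. -/
noncomputable def driftRatio (U : Kernel ℕ ℕ) (μ : ℝ) (x : ℕ) : ℝ :=
  2 * drift U μ x / diffusion U μ x

/-! Everything reduces to Lyapunov functions. If `V ≥ 0` tends to infinity and is superharmonic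
outside a finite set, the chain hits 0 almost surely (`IsMarkovChain.prob_visit_zero_eq_one`). If `V
> 0` tends to 0 and is superharmonic outside a finite set, a chain that has climbed high enough
avoids 0 with probability at least 1/2 (`IsMarkovChain.prob_avoid_zero_pos`).

The functions are `y` for μ < 1, `1/(1+y)` for μ > 1, and, for μ = 1, `log log (y+3)` (recurrence)
and `1/log (y+3)` (avoidance). Concentration makes the `k`-th centred absolute moment of `U x` of
order `x^(k/2)` (`exists_moment_bound`).

In the critical case put `t = (U x - x)/(x+3)` and `L = log (x+3)`, so that `E t ≈ ρ/x` and `E t² ≈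
ν/x`. To second order the mean increment of `log log` is `(ρ - (1 + 1/L) ν/2)/(x L)`, negative when
`θ < 1 + 1/L`. That of `1/log` is `(-ρ + (1/2 + 1/L) ν)/(x L²)`, negative when `θ > 1 + 2/L`.
Third-order remainders contribute `O(x^(-1/2)/ν)` on the scale of θ, and the margin `α x^(-1/2)`
absorbs this because `α ν → ∞`. -/

open scoped ENNReal

/-! ### The Markov property -/

section MarkovProperty

variable {Ω : Type*} [MeasurableSpace Ω] {P : Measure Ω} {U : Kernel ℕ ℕ} {Z : ℕ → Ω → ℕ}

/-- The one-step Markov property for functionals `g` of the path up to time `n`. -/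
lemma IsMarkovChain.lintegral_succ (hZ : IsMarkovChain P U Z) (n : ℕ) {g : (ℕ → ℕ) → ℝ≥0∞}
    (hg : ∀ x y : ℕ → ℕ, (∀ k ≤ n, x k = y k) → g x = g y) (f : ℕ → ℝ≥0∞) :
    ∫⁻ ω, g (fun k => Z k ω) * f (Z (n + 1) ω) ∂P
      = ∫⁻ ω, g (fun k => Z k ω) * ∫⁻ y, f y ∂(U (Z n ω)) ∂P := by
  let W : Ω → (Fin (n + 1) → ℕ) := fun ω k => Z k ω
  -- `e w y` prolongs a finite path by the constant `y`, so its value at time `n + 1` is `y` and the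
  -- Markov hypothesis describes the atoms of the joint law of `(W, Z (n + 1))`.
  let e : (Fin (n + 1) → ℕ) → ℕ → ℕ → ℕ := fun w y k => if h : k < n + 1 then w ⟨k, h⟩ else y
  have hW : Measurable W := measurable_pi_lambda _ fun k => hZ.measurable k
  have hWZ : Measurable fun ω => (W ω, Z (n + 1) ω) := hW.prodMk (hZ.measurable _)
  have he : ∀ w y k (hk : k ≤ n), e w y k = w ⟨k, Nat.lt_succ_of_le hk⟩ := fun w y k hk =>
    dif_pos (Nat.lt_succ_of_le hk)
  have hgW : ∀ ω, g (fun k => Z k ω) = g (e (W ω) 0) := fun ω => hg _ _ fun k hk => by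
    rw [he _ _ _ hk]
  have hpre : ∀ w, W ⁻¹' {w} = {ω | ∀ k ≤ n, Z k ω = e w 0 k} := by
    intro w
    ext ω
    simp only [Set.mem_preimage, Set.mem_singleton_iff, Set.mem_ofPred_eq, funext_iff, Fin.forall_iff]
    refine forall_congr' fun k => ⟨fun h hk => ?_, fun h hk => ?_⟩
    · rw [he _ _ _ hk]; exact h (Nat.lt_succ_of_le hk)
    · rw [← he w 0 k (Nat.le_of_lt_succ hk)]; exact h (Nat.le_of_lt_succ hk)
  have hprob : ∀ w y, P ((fun ω => (W ω, Z (n + 1) ω)) ⁻¹' {(w, y)})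
      = P (W ⁻¹' {w}) * U (w (Fin.last n)) {y} := by
    intro w y
    have h := hZ.markov n (e w y)
    have h1 : {ω | ∀ k ≤ n, Z k ω = e w y k} = W ⁻¹' {w} := by
      rw [hpre]
      ext ω
      refine forall_congr' fun k => forall_congr' fun hk => ?_
      rw [he _ _ _ hk, he _ _ _ hk]
    have h2 : {ω | ∀ k ≤ n + 1, Z k ω = e w y k}
        = (fun ω => (W ω, Z (n + 1) ω)) ⁻¹' {(w, y)} := by
      ext ω
      have := congrArg (ω ∈ ·) h1
      simp only [Set.mem_ofPred_eq, Set.mem_preimage, Set.mem_singleton_iff, eq_iff_iff] at this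
      simp only [Set.mem_ofPred_eq, Set.mem_preimage, Set.mem_singleton_iff, Prod.mk.injEq]
      rw [← this]
      constructor
      · intro h
        refine ⟨fun k hk => h k (by omega), ?_⟩
        simpa [e] using h (n + 1) le_rfl
      · rintro ⟨h3, h4⟩ k hk
        rcases Nat.lt_or_eq_of_le hk with hk | rfl
        · exact h3 k (by omega)
        · simpa [e] using h4
    rw [h1, h2] at h
    rw [h]
    simp [e, Fin.last]
  calc ∫⁻ ω, g (fun k => Z k ω) * f (Z (n + 1) ω) ∂P
      = ∫⁻ p, g (e p.1 0) * f p.2 ∂(P.map fun ω => (W ω, Z (n + 1) ω)) := by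
        rw [lintegral_map (measurable_of_countable _) hWZ]
        simp_rw [hgW]
    _ = ∑' w, ∑' y, g (e w 0) * f y * (P (W ⁻¹' {w}) * U (w (Fin.last n)) {y}) := by
        rw [lintegral_countable', ENNReal.tsum_prod']
        refine tsum_congr fun w => tsum_congr fun y => ?_
        rw [Measure.map_apply hWZ (measurableSet_singleton _), hprob]
    _ = ∑' w, (g (e w 0) * ∫⁻ y, f y ∂(U (w (Fin.last n)))) * P (W ⁻¹' {w}) := by
        refine tsum_congr fun w => ?_
        rw [lintegral_countable', ← ENNReal.tsum_mul_left, ← ENNReal.tsum_mul_right]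
        refine tsum_congr fun y => ?_
        ring
    _ = ∫⁻ w, g (e w 0) * ∫⁻ y, f y ∂(U (w (Fin.last n))) ∂(P.map W) := by
        rw [lintegral_countable']
        refine tsum_congr fun w => ?_
        rw [Measure.map_apply hW (measurableSet_singleton _)]
    _ = ∫⁻ ω, g (fun k => Z k ω) * ∫⁻ y, f y ∂(U (Z n ω)) ∂P := by
        rw [lintegral_map (measurable_of_countable _) hW]
        simp_rw [hgW]
        rfl

/-- `avoidProb U n x` is the probability that a chain with step distribution `U` started at `x`
does not visit `0` at the times `0, …, n`. -/
noncomputable def avoidProb (U : Kernel ℕ ℕ) : ℕ → ℕ → ℝ≥0∞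
  | 0, x => if x ≠ 0 then 1 else 0
  | n + 1, x => if x ≠ 0 then ∫⁻ y, avoidProb U n y ∂(U x) else 0

/-- Iterates the one-step property. The statement allows arbitrary `g` because each step of the
induction absorbs the factor `1{x n ≠ 0}` into it. -/
lemma IsMarkovChain.lintegral_avoidProb (hZ : IsMarkovChain P U Z) (m : ℕ) :
    ∀ (n : ℕ) {g : (ℕ → ℕ) → ℝ≥0∞}, (∀ x y : ℕ → ℕ, (∀ k ≤ n, x k = y k) → g x = g y) →
    ∫⁻ ω, g (fun k => Z k ω) * avoidProb U m (Z n ω) ∂P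
      = ∫⁻ ω, g (fun k => Z k ω) * Set.indicator {ω | ∀ k ≤ m, Z (n + k) ω ≠ 0} 1 ω ∂P := by
  classical
  induction m with
  | zero =>
    intro n g _
    refine lintegral_congr fun ω => ?_
    simp [avoidProb, Set.indicator_apply]
  | succ m ih =>
    intro n g hg
    have hg' : ∀ x y : ℕ → ℕ, (∀ k ≤ n, x k = y k) →
        g x * (if x n ≠ 0 then 1 else 0) = g y * (if y n ≠ 0 then 1 else 0) := fun x y h => by
      rw [hg x y h, h n le_rfl]
    calc ∫⁻ ω, g (fun k => Z k ω) * avoidProb U (m + 1) (Z n ω) ∂P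
        = ∫⁻ ω, (g (fun k => Z k ω) * (if Z n ω ≠ 0 then 1 else 0))
            * ∫⁻ y, avoidProb U m y ∂(U (Z n ω)) ∂P := by
          refine lintegral_congr fun ω => ?_
          simp only [avoidProb]
          split_ifs <;> simp
      _ = ∫⁻ ω, (g (fun k => Z k ω) * (if Z n ω ≠ 0 then 1 else 0))
            * avoidProb U m (Z (n + 1) ω) ∂P := (hZ.lintegral_succ n hg' _).symm
      _ = _ := by
          rw [ih (n + 1) (g := fun x => g x * (if x n ≠ 0 then 1 else 0))
            fun x y h => hg' x y fun k hk => h k (by omega)]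
          refine lintegral_congr fun ω => ?_
          have : (∀ k ≤ m + 1, Z (n + k) ω ≠ 0) ↔
              Z n ω ≠ 0 ∧ ∀ k ≤ m, Z (n + 1 + k) ω ≠ 0 := by
            constructor
            · refine fun h => ⟨by simpa using h 0 (by omega), fun k hk => ?_⟩
              have := h (k + 1) (by omega)
              rwa [show n + 1 + k = n + (k + 1) by omega]
            · rintro ⟨h0, h⟩ k hk
              rcases k with _ | k
              · simpa using h0
              · have := h k (by omega)
                rwa [show n + (k + 1) = n + 1 + k by omega]
          simp only [Set.indicator_apply, Set.mem_ofPred_eq, this, Pi.one_apply]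
          by_cases h0 : Z n ω = 0 <;> simp [h0]

end MarkovProperty

/-! ### Avoidance probabilities -/

section Avoid

/-- The probability that a chain with step distribution `U` started at `x` never visits `0`. -/
noncomputable def neverProb (U : Kernel ℕ ℕ) (x : ℕ) : ℝ≥0∞ := ⨅ n, avoidProb U n x

lemma neverProb_zero (U : Kernel ℕ ℕ) : neverProb U 0 = 0 :=
  le_antisymm ((iInf_le _ 0).trans (by simp [avoidProb])) (by simp)

/-- A nonempty set that an irreducible chain cannot leave is the whole state space. -/
lemma mem_of_closed_of_isIrreducible (U : Kernel ℕ ℕ) (hirr : Kernel.IsIrreducible Measure.count U) {S : Set ℕ}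
    (hS : ∀ x ∈ S, ∀ᵐ y ∂(U x), y ∈ S) {x : ℕ} (hx : x ∈ S) (z : ℕ) : z ∈ S := by
  have hn : ∀ n : ℕ, ∀ x ∈ S, (U ^ n) x Sᶜ = 0 := by
    intro n
    induction n with
    | zero =>
      intro x hx
      have : (U ^ 0) x = Measure.dirac x := by
        rw [pow_zero]; exact Kernel.id_apply x
      rw [this, Measure.dirac_apply' _ (MeasurableSet.of_discrete)]
      simpa using hx
    | succ n ih =>
      intro x hx
      rw [pow_succ]
      change ((U ^ n) ∘ₖ U) x Sᶜ = 0
      rw [Kernel.comp_apply' _ _ _ MeasurableSet.of_discrete,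
        lintegral_eq_zero_iff (measurable_of_countable _)]
      filter_upwards [hS x hx] with y hy using ih y hy
  by_contra hz
  obtain ⟨n, hpos⟩ := hirr.irreducible (measurableSet_singleton z) (by simp) x
  refine hpos.ne' (measure_mono_null ?_ (hn n x hx))
  simpa using hz

variable (U : Kernel ℕ ℕ) [IsMarkovKernel U]

lemma avoidProb_le_one (n x : ℕ) : avoidProb U n x ≤ 1 := by
  induction n generalizing x with
  | zero => simp only [avoidProb]; split_ifs <;> simp
  | succ n ih =>
    simp only [avoidProb]
    split_ifs
    · exact (lintegral_mono ih).trans (by simp)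
    · simp

lemma avoidProb_succ_le (n x : ℕ) : avoidProb U (n + 1) x ≤ avoidProb U n x := by
  induction n generalizing x with
  | zero =>
    simp only [avoidProb]
    split_ifs
    · exact (lintegral_mono (avoidProb_le_one U 0)).trans (by simp)
    · simp
  | succ n ih =>
    rw [avoidProb, avoidProb]
    split_ifs
    · exact lintegral_mono ih
    · simp

lemma antitone_avoidProb : Antitone (avoidProb U) :=
  antitone_nat_of_succ_le fun n x => avoidProb_succ_le U n x

lemma neverProb_le_one (x : ℕ) : neverProb U x ≤ 1 :=
  (iInf_le _ 0).trans (avoidProb_le_one U 0 x)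

/-- The recursion for `avoidProb` passes to its decreasing limit, which is bounded by 1. This
harmonicity off 0 feeds the maximum principle. -/
lemma neverProb_eq_lintegral {x : ℕ} (hx : x ≠ 0) :
    neverProb U x = ∫⁻ y, neverProb U y ∂(U x) := by
  simp only [neverProb]
  rw [lintegral_iInf (fun n => measurable_of_countable _) (antitone_avoidProb U)]
  · refine le_antisymm (le_iInf fun n => ?_) (le_iInf fun n => ?_)
    · exact (iInf_le _ (n + 1)).trans (by simp [avoidProb, hx])
    · refine (iInf_le _ n).trans ?_
      refine le_trans (le_of_eq ?_) (avoidProb_succ_le U n x)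
      simp [avoidProb, hx]
  · exact ((lintegral_mono (avoidProb_le_one U 0)).trans_lt (by simp)).ne

lemma integrable_toReal_neverProb (x : ℕ) :
    Integrable (fun y => (neverProb U y).toReal) (U x) := by
  refine Integrable.of_bound (C := 1) (measurable_of_countable _).aestronglyMeasurable
    (ae_of_all _ fun y => ?_)
  rw [Real.norm_of_nonneg ENNReal.toReal_nonneg]
  exact ENNReal.toReal_mono ENNReal.one_ne_top (neverProb_le_one U y)

lemma toReal_neverProb_eq_integral {x : ℕ} (hx : x ≠ 0) :
    (neverProb U x).toReal = ∫ y, (neverProb U y).toReal ∂(U x) := by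
  rw [integral_toReal (measurable_of_countable _).aemeasurable
    (ae_of_all _ fun y => (neverProb_le_one U y).trans_lt ENNReal.one_lt_top),
    ← neverProb_eq_lintegral U hx]

/-- The maximum principle: a function that is subharmonic at its maximum points other than `0`
attains its maximum at `0`. -/
lemma le_apply_zero_of_subharmonic (hirr : Kernel.IsIrreducible Measure.count U) {f : ℕ → ℝ}
    {b : ℕ} (hb : ∀ y, f y ≤ f b)
    (hf : ∀ x, f x = f b → x ≠ 0 → Integrable f (U x) ∧ f x ≤ ∫ y, f y ∂(U x)) :
    f b ≤ f 0 := by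
  by_contra! hlt
  have hS : ∀ x ∈ {x | f x = f b}, ∀ᵐ y ∂(U x), y ∈ {x | f x = f b} := by
    intro x hx
    have hx0 : x ≠ 0 := by rintro rfl; exact hlt.ne hx
    obtain ⟨hi, hle⟩ := hf x hx hx0
    have hint : Integrable (fun y => f b - f y) (U x) := (integrable_const _).sub hi
    have h0 : ∫ y, (f b - f y) ∂(U x) = 0 := by
      refine le_antisymm ?_ (integral_nonneg fun y => sub_nonneg.2 (hb y))
      rw [integral_sub (integrable_const _) hi]
      have : f x = f b := hx
      simp
      linarith
    rw [integral_eq_zero_iff_of_nonneg (fun y => sub_nonneg.2 (hb y)) hint] at h0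
    filter_upwards [h0] with y hy
    have hy' : f b - f y = 0 := hy
    change f y = f b
    linarith
  exact hlt.ne (mem_of_closed_of_isIrreducible U hirr hS (x := b) rfl 0)

/-- A nonnegative function tending to infinity which is superharmonic outside a finite set forces
the chain to visit `0`. -/
lemma neverProb_eq_zero_of_lyapunov (hirr : Kernel.IsIrreducible Measure.count U) {V : ℕ → ℝ}
    (hV0 : ∀ x, 0 ≤ V x) (hV : Tendsto V atTop atTop)
    (hsup : ∀ᶠ x in atTop, Integrable V (U x) ∧ ∫ y, V y ∂(U x) ≤ V x) (x : ℕ) :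
    neverProb U x = 0 := by
  obtain ⟨N, hN⟩ := eventually_atTop.1 hsup
  set q : ℕ → ℝ := fun x => (neverProb U x).toReal with hq
  have hq1 : ∀ x, q x ≤ 1 := fun x =>
    ENNReal.toReal_mono ENNReal.one_ne_top (neverProb_le_one U x)
  have hq0 : q 0 = 0 := by simp [hq, neverProb_zero]
  obtain ⟨b, -, hbmax⟩ := (Finset.range (N + 1)).exists_max_image q ⟨0, by simp⟩
  -- The penalised function attains its maximum since `V → ∞`. A maximum exceeding `q b` could only
  -- be attained above `N`, where the function is subharmonic; the maximum principle would then
  -- carry it to 0, where the value is at most `q b`.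
  have hqb : ∀ ε > 0, ∀ x, q x - ε * V x ≤ q b := by
    intro ε hε
    set f : ℕ → ℝ := fun x => q x - ε * V x with hf
    have hfsmall : ∀ᶠ x in atTop, f x ≤ f 0 := by
      filter_upwards [hV.eventually_ge_atTop ((1 - f 0) / ε)] with x hx
      rw [div_le_iff₀ hε] at hx
      have := hq1 x
      simp only [hf] at hx ⊢
      linarith
    obtain ⟨M, hM⟩ := eventually_atTop.1 hfsmall
    obtain ⟨a, -, hamax⟩ := (Finset.range (M + 1)).exists_max_image f ⟨0, by simp⟩
    have ha : ∀ y, f y ≤ f a := by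
      intro y
      by_cases hy : y ≤ M
      · exact hamax y (by simp; omega)
      · exact (hM y (by omega)).trans (hamax 0 (by simp))
    have hfq : ∀ y, f y ≤ q y := fun y => by
      have := mul_nonneg hε.le (hV0 y)
      simp only [hf]; linarith
    intro x
    refine (ha x).trans ?_
    by_contra! hlt
    have h := le_apply_zero_of_subharmonic U hirr ha fun y hy hy0 => ?_
    · have := hfq 0
      have := hbmax 0 (by simp)
      linarith
    · have hyN : N ≤ y := by
        by_contra! hyN
        have := hfq y
        have := hbmax y (by simp; omega)
        linarith
      obtain ⟨hi, hle⟩ := hN y hyN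
      have hqi := integrable_toReal_neverProb U y
      refine ⟨hqi.sub (hi.const_mul ε), ?_⟩
      rw [integral_sub hqi (hi.const_mul ε), integral_const_mul,
        ← toReal_neverProb_eq_integral U hy0]
      have := mul_le_mul_of_nonneg_left hle hε.le
      simp only [hf, hq]
      linarith
  -- Let `ε → 0`; the denominator `V x + 1` below avoids dividing by zero.
  have hqle : ∀ x, q x ≤ q b := by
    intro x
    refine le_of_forall_pos_le_add fun δ hδ => ?_
    have hpos : 0 < V x + 1 := by linarith [hV0 x]
    have h := hqb (δ / (V x + 1)) (by positivity) x
    have : δ / (V x + 1) * V x ≤ δ := by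
      rw [div_mul_eq_mul_div, div_le_iff₀ hpos]
      nlinarith [hV0 x]
    linarith
  -- Now `q` itself attains its maximum and is harmonic off 0, so the maximum is `q 0 = 0`.
  have hb0 : q b ≤ q 0 := le_apply_zero_of_subharmonic U hirr hqle fun y _ hy0 =>
    ⟨integrable_toReal_neverProb U y, (toReal_neverProb_eq_integral U hy0).le⟩
  have hx0 : q x = 0 := le_antisymm ((hqle x).trans (hb0.trans hq0.le)) ENNReal.toReal_nonneg
  exact ((ENNReal.toReal_eq_zero_iff _).1 hx0).resolve_right
    ((neverProb_le_one U x).trans_lt ENNReal.one_lt_top).ne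

/-- If `V` is superharmonic above level `N` and at least `v` below it, then `0` is avoided from
`x` with probability at least `1 - V x / v`. -/
lemma one_le_avoidProb_add {V : ℕ → ℝ≥0∞} {N : ℕ} {v : ℝ≥0∞} (hN : 0 < N) (hv0 : v ≠ 0)
    (hvt : v ≠ ∞) (hv : ∀ x < N, v ≤ V x) (hsup : ∀ x, N ≤ x → ∫⁻ y, V y ∂(U x) ≤ V x)
    (n x : ℕ) : 1 ≤ avoidProb U n x + V x / v := by
  have hsmall : ∀ n, ∀ x < N, 1 ≤ avoidProb U n x + V x / v := fun n x hx =>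
    le_add_left ((ENNReal.le_div_iff_mul_le (Or.inl hv0) (Or.inl hvt)).2 (by simpa using hv x hx))
  induction n generalizing x with
  | zero =>
    rcases lt_or_ge x N with hx | hx
    · exact hsmall 0 x hx
    · have : x ≠ 0 := by omega
      simp [avoidProb, this]
  | succ n ih =>
    rcases lt_or_ge x N with hx | hx
    · exact hsmall _ x hx
    · have hx0 : x ≠ 0 := by omega
      -- Above `N` the induction hypothesis is integrated against `U x`; below `N` the term `V x /
      -- v` alone is at least 1.
      calc (1 : ℝ≥0∞) = ∫⁻ _, 1 ∂(U x) := by simp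
        _ ≤ ∫⁻ y, (avoidProb U n y + V y / v) ∂(U x) := lintegral_mono ih
        _ = avoidProb U (n + 1) x + (∫⁻ y, V y ∂(U x)) / v := by
          rw [lintegral_add_left (measurable_of_countable _)]
          simp only [div_eq_mul_inv]
          rw [lintegral_mul_const _ (measurable_of_countable _)]
          simp [avoidProb, hx0]
        _ ≤ _ := by gcongr; exact hsup x hx

end Avoid

/-! ### Lyapunov criteria -/

section Criteria

variable {Ω : Type*} [MeasurableSpace Ω] {P : Measure Ω} [IsProbabilityMeasure P]
  {U : Kernel ℕ ℕ} [IsMarkovKernel U] {Z : ℕ → Ω → ℕ}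

/-- Recurrence criterion. -/
theorem IsMarkovChain.prob_visit_zero_eq_one (hZ : IsMarkovChain P U Z)
    (hirr : Kernel.IsIrreducible Measure.count U) {V : ℕ → ℝ}
    (hV0 : ∀ x, 0 ≤ V x) (hV : Tendsto V atTop atTop)
    (hsup : ∀ᶠ x in atTop, Integrable V (U x) ∧ ∫ y, V y ∂(U x) ≤ V x) :
    P {ω | ∃ n, Z n ω = 0} = 1 := by
  have hmeas : MeasurableSet {ω | ∃ n, Z n ω = 0} := by
    rw [Set.ofPred_exists]
    exact MeasurableSet.iUnion fun n => hZ.measurable n (measurableSet_singleton 0)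
  rw [← prob_compl_eq_zero_iff hmeas]
  have hlim : ∫⁻ ω, neverProb U (Z 0 ω) ∂P = 0 := by
    simp [neverProb_eq_zero_of_lyapunov U hirr hV0 hV hsup]
  rw [← nonpos_iff_eq_zero, ← hlim]
  simp only [neverProb]
  rw [lintegral_iInf (f := fun n ω => avoidProb U n (Z 0 ω))
    (fun n => (measurable_of_countable _).comp (hZ.measurable 0)) fun i j hij ω => antitone_avoidProb U hij _]
  · refine le_iInf fun m => ?_
    have h := hZ.lintegral_avoidProb m 0 (g := fun _ => 1) fun _ _ _ => rfl
    simp only [one_mul, zero_add] at h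
    rw [h, lintegral_indicator_one]
    · refine measure_mono fun ω hω k _ hk => hω ⟨k, hk⟩
    · simp only [Set.ofPred_forall]
      exact MeasurableSet.iInter fun k => MeasurableSet.iInter fun _ =>
        (hZ.measurable k (measurableSet_singleton 0)).compl
  · exact ((lintegral_mono fun ω => avoidProb_le_one U 0 _).trans_lt (by simp)).ne

/-- Transience criterion. -/
theorem IsMarkovChain.prob_avoid_zero_pos (hZ : IsMarkovChain P U Z)
    (hclimb : CanClimbBeforeZero P Z) {V : ℕ → ℝ} (hV0 : ∀ x, 0 < V x)
    (hV : Tendsto V atTop (𝓝 0))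
    (hsup : ∀ᶠ x in atTop, Integrable V (U x) ∧ ∫ y, V y ∂(U x) ≤ V x) :
    0 < P {ω | ∀ n, 0 < Z n ω} := by
  obtain ⟨N, hN⟩ := eventually_atTop.1 hsup
  obtain ⟨b, -, hb⟩ := (Finset.range (N + 1)).exists_min_image V ⟨0, by simp⟩
  have hbound : ∀ n x, 1 ≤ avoidProb U n x + ENNReal.ofReal (V x) / ENNReal.ofReal (V b) := by
    refine one_le_avoidProb_add U (N := N + 1) (V := fun x => ENNReal.ofReal (V x))
      (Nat.succ_pos N) (by simpa using hV0 b) ENNReal.ofReal_ne_top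
      (fun x hx => ENNReal.ofReal_le_ofReal (hb x (by simpa using hx))) fun x hx => ?_
    obtain ⟨hi, hle⟩ := hN x (by omega)
    rw [← ofReal_integral_eq_lintegral_ofReal hi (ae_of_all _ fun y => (hV0 y).le)]
    exact ENNReal.ofReal_le_ofReal hle
  -- Beyond `M` the ratio `V x / V b` is at most 1/2, so 0 is avoided with probability at least 1/2,
  -- uniformly in the time horizon.
  obtain ⟨M, hM⟩ := eventually_atTop.1 (hV.eventually_lt_const (half_pos (hV0 b)))
  have hhalf : ∀ m x, M ≤ x → 2⁻¹ ≤ avoidProb U m x := by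
    intro m x hx
    have h1 : ENNReal.ofReal (V x) / ENNReal.ofReal (V b) ≤ 2⁻¹ := by
      rw [← ENNReal.ofReal_div_of_pos (hV0 b), ← ENNReal.ofReal_ofNat, ← ENNReal.ofReal_inv_of_pos two_pos]
      refine ENNReal.ofReal_le_ofReal ?_
      rw [div_le_iff₀ (hV0 b)]
      linarith [hM x hx]
    have h2 := (hbound m x).trans (add_le_add_right h1 _)
    rw [← ENNReal.inv_two_add_inv_two] at h2
    exact (ENNReal.add_le_add_iff_right (by simp)).1 h2
  obtain ⟨n, hn⟩ := hclimb M
  set A : Set Ω := {ω | M ≤ Z n ω ∧ ∀ k ≤ n, 0 < Z k ω} with hA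
  have hmA : MeasurableSet A := by
    have : A = Z n ⁻¹' Set.Ici M ∩ ⋂ k, ⋂ (_ : k ≤ n), Z k ⁻¹' Set.Ioi 0 := by
      ext ω; simp [hA]
    rw [this]
    exact (hZ.measurable n measurableSet_Ici).inter <| MeasurableSet.iInter fun k => MeasurableSet.iInter fun _ =>
      hZ.measurable k measurableSet_Ioi
  let E : ℕ → Set Ω := fun m => {ω | ∀ k ≤ m, Z (n + k) ω ≠ 0}
  have hmE : ∀ m, MeasurableSet (E m) := fun m => by
    simp only [E, Set.ofPred_forall]
    exact MeasurableSet.iInter fun k => MeasurableSet.iInter fun _ =>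
      (hZ.measurable (n + k) (measurableSet_singleton 0)).compl
  have hlow : ∀ m, 2⁻¹ * P A ≤ P (A ∩ E m) := by
    classical
    intro m
    -- The indicator of the climbing event `A` depends only on the path up to time `n`, so the
    -- Markov property restarts the chain from `Z n ≥ M`.
    let g : (ℕ → ℕ) → ℝ≥0∞ := fun x => if M ≤ x n ∧ ∀ k ≤ n, 0 < x k then 1 else 0
    have hg : ∀ x y : ℕ → ℕ, (∀ k ≤ n, x k = y k) → g x = g y := by
      intro x y h
      have : (M ≤ x n ∧ ∀ k ≤ n, 0 < x k) ↔ (M ≤ y n ∧ ∀ k ≤ n, 0 < y k) := by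
        rw [h n le_rfl]
        exact and_congr_right fun _ => forall_congr' fun k => forall_congr' fun hk => by rw [h k hk]
      simp only [g, this]
    have h := hZ.lintegral_avoidProb m n hg
    have h1 : ∫⁻ ω, g (fun k => Z k ω) * (E m).indicator 1 ω ∂P = P (A ∩ E m) := by
      rw [← lintegral_indicator_one (hmA.inter (hmE m))]
      refine lintegral_congr fun ω => ?_
      rw [Set.inter_indicator_one]
      simp only [g, Pi.mul_apply, Set.indicator_apply, hA, Set.mem_ofPred_eq, Pi.one_apply]
    rw [← h1, ← h, ← lintegral_indicator_one hmA, ← lintegral_const_mul _ (measurable_one.indicator hmA)]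
    refine lintegral_mono fun ω => ?_
    by_cases hω : ω ∈ A
    · have hgω : g (fun k => Z k ω) = 1 := if_pos hω
      simpa [hgω, hω] using hhalf m _ hω.1
    · simp [hω]
  have hanti : Antitone fun m => A ∩ E m := fun i j hij =>
    Set.inter_subset_inter_right _ fun ω hω k hk => hω k (hk.trans hij)
  have hlim := tendsto_measure_iInter_atTop (μ := P)
    (fun m => (hmA.inter (hmE m)).nullMeasurableSet) hanti ⟨0, measure_ne_top _ _⟩
  have hle : 2⁻¹ * P A ≤ P (⋂ m, A ∩ E m) := ge_of_tendsto' hlim hlow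
  refine (lt_of_lt_of_le (by simpa using hn) hle).trans_le (measure_mono fun ω hω k => ?_)
  rw [Set.mem_iInter] at hω
  rcases le_total k n with hk | hk
  · exact (hω 0).1.2 k hk
  · have := (hω (k - n)).2 (k - n) le_rfl
    rw [Nat.add_sub_cancel' hk] at this
    omega

end Criteria

/-! ### Moments of the steps -/

lemma summable_succ_pow_mul_exp {a : ℝ} (ha : 0 < a) (k : ℕ) :
    Summable fun j : ℕ => ((j : ℝ) + 1) ^ k * (2 * Real.exp (-a * j)) := by
  have h1 : ‖Real.exp (-a)‖ < 1 := by
    rw [Real.norm_of_nonneg (Real.exp_pos _).le, Real.exp_lt_one_iff]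
    linarith
  have h0 : Summable fun n : ℕ => (n : ℝ) ^ k * Real.exp (-a) ^ n :=
    summable_pow_mul_geometric_of_norm_lt_one k h1
  have h2 : Summable fun n : ℕ => ((n + 1 : ℕ) : ℝ) ^ k * Real.exp (-a) ^ (n + 1) :=
    (summable_nat_add_iff (f := fun n : ℕ => (n : ℝ) ^ k * Real.exp (-a) ^ n) 1).2 h0
  have h3 : Real.exp a * Real.exp (-a) = 1 := by rw [← Real.exp_add]; simp
  refine (h2.mul_left (2 * Real.exp a)).congr fun j => ?_
  have h4 : Real.exp (-a * j) = Real.exp (-a) ^ j := by rw [← Real.exp_nat_mul, mul_comm]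
  rw [h4, pow_succ]
  push_cast
  calc 2 * Real.exp a * (((j : ℝ) + 1) ^ k * (Real.exp (-a) ^ j * Real.exp (-a)))
      = ((j : ℝ) + 1) ^ k * (2 * Real.exp (-a) ^ j) * (Real.exp a * Real.exp (-a)) := by ring
    _ = _ := by rw [h3, mul_one]

/-- Moments of a variable with exponential tails are bounded by a constant that depends only on
the rate. -/
lemma integrable_pow_and_integral_le_of_exp_tail {a : ℝ} (ha : 0 < a) {k : ℕ} (hk : k ≠ 0)
    (m : Measure ℕ) [IsProbabilityMeasure m] {D : ℕ → ℝ} (hD : ∀ y, 0 ≤ D y)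
    (htail : ∀ j : ℕ, 1 ≤ j → m.real {y | (j : ℝ) < D y} ≤ 2 * Real.exp (-a * j)) :
    Integrable (fun y => D y ^ k) m ∧
      ∫ y, D y ^ k ∂m ≤ ∑' j : ℕ, ((j : ℝ) + 1) ^ k * (2 * Real.exp (-a * j)) := by
  have hnn : ∀ j : ℕ, 0 ≤ ((j : ℝ) + 1) ^ k * (2 * Real.exp (-a * j)) := fun j => by positivity
  -- The single term `j = ⌈D y⌉ - 1` suffices, since `j < D y ≤ j + 1`; for `D y = 0` the condition
  -- `k ≠ 0` is needed.
  have hpt : ∀ y, ENNReal.ofReal (D y ^ k) ≤ ∑' j : ℕ, ENNReal.ofReal (((j : ℝ) + 1) ^ k) *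
      {y | (j : ℝ) < D y}.indicator 1 y := by
    intro y
    rcases (hD y).eq_or_lt with h0 | hpos
    · simp [← h0, hk]
    · obtain ⟨j, hj⟩ := Nat.exists_eq_succ_of_ne_zero (Nat.ceil_pos.2 hpos).ne'
      have hlt : (j : ℝ) < D y := Nat.lt_ceil.1 (by omega)
      have hle : D y ≤ (j : ℝ) + 1 := by
        have := Nat.le_ceil (D y)
        rw [hj] at this
        simpa using this
      refine le_trans ?_ (ENNReal.le_tsum j)
      rw [Set.indicator_of_mem (by exact hlt)]
      simpa using ENNReal.ofReal_le_ofReal (pow_le_pow_left₀ (hD y) hle k)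
  have hlint : ∫⁻ y, ENNReal.ofReal (D y ^ k) ∂m
      ≤ ENNReal.ofReal (∑' j : ℕ, ((j : ℝ) + 1) ^ k * (2 * Real.exp (-a * j))) := by
    refine (lintegral_mono hpt).trans ?_
    rw [lintegral_tsum fun j => (measurable_of_countable _).aemeasurable,
      ENNReal.ofReal_tsum_of_nonneg hnn (summable_succ_pow_mul_exp ha k)]
    refine ENNReal.tsum_le_tsum fun j => ?_
    rw [lintegral_const_mul _ (measurable_of_countable _),
      lintegral_indicator_one MeasurableSet.of_discrete, ENNReal.ofReal_mul (by positivity)]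
    gcongr
    rw [← ofReal_measureReal]
    refine ENNReal.ofReal_le_ofReal ?_
    -- At `j = 0` the bound equals 2 and is trivial for a probability.
    rcases Nat.eq_zero_or_pos j with rfl | hj
    · refine measureReal_le_one.trans ?_
      simp
    · exact htail j hj
  have hmeas : AEStronglyMeasurable (fun y => D y ^ k) m :=
    (measurable_of_countable _).aestronglyMeasurable
  have hnonneg : 0 ≤ᵐ[m] fun y => D y ^ k := ae_of_all _ fun y => pow_nonneg (hD y) k
  refine ⟨(lintegral_ofReal_ne_top_iff_integrable hmeas hnonneg).1
    (hlint.trans_lt ENNReal.ofReal_lt_top).ne, ?_⟩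
  rw [integral_eq_lintegral_of_nonneg_ae hnonneg hmeas]
  exact ENNReal.toReal_le_of_le_ofReal (tsum_nonneg hnn) hlint

section Moments

variable {U : Kernel ℕ ℕ} {μ c : ℝ}

/-- The `k`-th absolute centred moment of `U x` is `O(x ^ (k / 2))`. -/
lemma exists_moment_bound [IsMarkovKernel U] (hμ : 0 ≤ μ) (hc : 0 < c)
    (hconc : ∀ᶠ x : ℕ in atTop, ∀ ε : ℝ, 0 < ε →
      (U x).real {y : ℕ | ε < |(y : ℝ) / x - μ|}
        ≤ 2 * Real.exp (-(c * ε ^ 2 / (1 + μ + ε)) * x)) {k : ℕ} (hk : k ≠ 0) :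
    ∃ C : ℝ, 0 ≤ C ∧ ∀ᶠ x : ℕ in atTop,
      Integrable (fun y : ℕ => |(y : ℝ) - μ * x| ^ k) (U x) ∧
      ∫ y : ℕ, |(y : ℝ) - μ * x| ^ k ∂(U x) ≤ C * √x ^ k := by
  -- Take `ε = j/√x` with `j ≥ 1`. The exponent becomes `c j²/(1 + μ + j/√x)`, and `1 + μ + j/√x ≤
  -- (2 + μ) j` leaves the rate `c/(2 + μ)`, free of `x`.
  have ha : 0 < c / (2 + μ) := by positivity
  refine ⟨∑' j : ℕ, ((j : ℝ) + 1) ^ k * (2 * Real.exp (-(c / (2 + μ)) * j)),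
    tsum_nonneg fun j => by positivity, ?_⟩
  filter_upwards [hconc, eventually_ge_atTop 1] with x hx hx1
  have hx1' : (1 : ℝ) ≤ x := by exact_mod_cast hx1
  have hx0 : (0 : ℝ) < x := by linarith
  have hs0 : 0 < √(x : ℝ) := Real.sqrt_pos.2 hx0
  have hs1 : 1 ≤ √(x : ℝ) := Real.one_le_sqrt.2 hx1'
  have hsq : √(x : ℝ) ^ 2 = x := Real.sq_sqrt hx0.le
  obtain ⟨hi, hle⟩ := integrable_pow_and_integral_le_of_exp_tail ha hk (U x)
    (D := fun y => |(y : ℝ) - μ * x| / √x) (fun y => by positivity) fun j hj => by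
      have hj1 : (1 : ℝ) ≤ j := by exact_mod_cast hj
      have hset : {y : ℕ | (j : ℝ) < |(y : ℝ) - μ * x| / √x}
          = {y : ℕ | j / √x < |(y : ℝ) / x - μ|} := by
        ext y
        have : |(y : ℝ) / x - μ| = |(y : ℝ) - μ * x| / √x / √x := by
          rw [div_div, ← sq, hsq, show (y : ℝ) / x - μ = (y - μ * x) / x by field_simp,
            abs_div, abs_of_pos hx0]
        simp only [Set.mem_ofPred_eq]
        rw [this, div_lt_div_iff_of_pos_right hs0]
      rw [hset]
      refine (hx (j / √x) (by positivity)).trans ?_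
      refine mul_le_mul_of_nonneg_left (Real.exp_le_exp.2 ?_) two_pos.le
      rw [neg_mul, neg_mul, neg_le_neg_iff, div_pow, hsq]
      have h1 : 1 + μ + j / √x ≤ (2 + μ) * j := by
        have : (j : ℝ) / √x ≤ j := div_le_self (by linarith) hs1
        nlinarith
      have h2 : c * ((j : ℝ) ^ 2 / x) / (1 + μ + j / √x) * x = c * j ^ 2 / (1 + μ + j / √x) := by
        field_simp
      rw [h2, show c / (2 + μ) * j = c * (j : ℝ) ^ 2 / ((2 + μ) * j) by field_simp]
      gcongr
  have heq : ∀ y : ℕ, |(y : ℝ) - μ * x| ^ k = (|(y : ℝ) - μ * x| / √x) ^ k * √x ^ k := by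
    intro y
    rw [div_pow, div_mul_cancel₀ _ (pow_pos hs0 k).ne']
  simp_rw [heq]
  refine ⟨hi.mul_const _, ?_⟩
  rw [integral_mul_const]
  gcongr

lemma stepMean_limit_nonneg (hμ : Tendsto (fun x : ℕ => stepMean U x / x) atTop (𝓝 μ)) : 0 ≤ μ :=
  ge_of_tendsto' hμ fun x => div_nonneg (integral_nonneg fun y => Nat.cast_nonneg y)
    (Nat.cast_nonneg x)

end Moments

/-! ### Inequalities for the logarithm -/

/-- The difference of the two sides has derivative `v³/(1+v)`, of the sign of `v`, hence its minimum
is at 0. Stopping at an odd power gives an upper bound on both sides of 0. -/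
lemma log_one_add_le_cubic {u : ℝ} (hu : -1 < u) :
    Real.log (1 + u) ≤ u - u ^ 2 / 2 + u ^ 3 / 3 := by
  let h : ℝ → ℝ := fun u => u - u ^ 2 / 2 + u ^ 3 / 3 - Real.log (1 + u)
  have hd : ∀ v, -1 < v → HasDerivAt h (v ^ 3 / (1 + v)) v := by
    intro v hv
    have hv' : 1 + v ≠ 0 := by linarith
    have h1 := (((hasDerivAt_id v).sub (((hasDerivAt_id v).pow 2).div_const 2)).add
      (((hasDerivAt_id v).pow 3).div_const 3)).sub (((hasDerivAt_id v).const_add 1).log hv')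
    refine h1.congr_deriv ?_
    simp only [id]
    field_simp
    ring
  have h0 : h 0 = 0 := by simp [h]
  suffices 0 ≤ h u by simp only [h] at this; linarith
  rw [← h0]
  rcases le_total 0 u with hu0 | hu0
  · refine monotoneOn_of_deriv_nonneg (convex_Icc 0 u) ?_ ?_ ?_ (by simp [hu0]) (by simp [hu0]) hu0
    · exact fun v hv => (hd v (by linarith [hv.1])).continuousAt.continuousWithinAt
    · intro v hv
      rw [interior_Icc] at hv
      exact (hd v (by linarith [hv.1])).differentiableAt.differentiableWithinAt
    · intro v hv
      rw [interior_Icc] at hv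
      rw [(hd v (by linarith [hv.1])).deriv]
      have := hv.1
      positivity
  · refine antitoneOn_of_deriv_nonpos (convex_Icc u 0) ?_ ?_ ?_ (by simp [hu0]) (by simp [hu0]) hu0
    · exact fun v hv => (hd v (by linarith [hv.1])).continuousAt.continuousWithinAt
    · intro v hv
      rw [interior_Icc] at hv
      exact (hd v (by linarith [hv.1])).differentiableAt.differentiableWithinAt
    · intro v hv
      rw [interior_Icc] at hv
      rw [(hd v (by linarith [hv.1])).deriv]
      refine div_nonpos_of_nonpos_of_nonneg ?_ (by linarith [hv.1])
      exact (Odd.pow_neg (by decide) hv.2).le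

/-- A one-sided third order expansion of the iterated logarithm, valid for all increments. -/
lemma log_log_increment_le {L t : ℝ} (hL : 1 ≤ L) (ht : -1 < t) (hLt : 0 < L + Real.log (1 + t)) :
    Real.log (L + Real.log (1 + t)) - Real.log L
      ≤ (t - (1 + 1 / L) * t ^ 2 / 2 + 12 * (|t| ^ 3 + |t| ^ 9)) / L := by
  have hL0 : 0 < L := by linarith
  set s := Real.log (1 + t)
  -- The cubic bound is applied twice: `p` majorises `log (1+t)`, then `log (1 + p/L)` is expanded.
  -- The ninth power in the remainder comes from `p³`.
  set p := t - t ^ 2 / 2 + t ^ 3 / 3 with hp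
  have hsp : s ≤ p := log_one_add_le_cubic ht
  have hp1 : -1 < p / L := by
    rw [lt_div_iff₀ hL0]; linarith
  have h1 : Real.log (L + s) - Real.log L ≤ Real.log (1 + p / L) := by
    rw [← Real.log_div hLt.ne' hL0.ne']
    refine Real.log_le_log (by positivity) ?_
    rw [div_le_iff₀ hL0, add_mul, div_mul_cancel₀ _ hL0.ne']
    linarith
  have hsq : t ^ 2 - |t| ^ 3 ≤ p ^ 2 := by
    have h3 : t ^ 3 ≤ |t| ^ 3 := (le_abs_self _).trans_eq (abs_pow t 3)
    have : p ^ 2 = t ^ 2 - t ^ 3 + 2 / 3 * t ^ 4 + (p - t) ^ 2 := by rw [hp]; ring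
    rw [this]
    nlinarith [sq_nonneg (p - t), sq_nonneg (t ^ 2)]
  set T := |t| with hT
  have hT0 : 0 ≤ T := abs_nonneg t
  have hpabs : |p| ≤ 2 * (T + T ^ 3) := by
    have h2 : t ^ 2 = T ^ 2 := (sq_abs t).symm
    have h3 : |t ^ 3| = T ^ 3 := abs_pow t 3
    have := abs_le.1 h3.le
    have := abs_le.1 (le_refl T)
    have : T ^ 2 ≤ T + T ^ 3 := by nlinarith [mul_nonneg hT0 (sq_nonneg (T - 1)), mul_nonneg hT0 hT0]
    have := pow_nonneg hT0 3
    rw [abs_le, hp, h2]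
    have := abs_le.1 hT.ge
    have := sq_nonneg T
    constructor <;> linarith
  have hp3 : p ^ 3 ≤ 32 * (T ^ 3 + T ^ 9) := by
    calc p ^ 3 ≤ |p| ^ 3 := (le_abs_self _).trans_eq (abs_pow p 3)
      _ ≤ (2 * (T + T ^ 3)) ^ 3 := by gcongr
      _ ≤ 32 * (T ^ 3 + T ^ 9) := by
        have h := add_pow_le (a := T) (b := T ^ 3) hT0 (by positivity) 3
        have : (T ^ 3) ^ 3 = T ^ 9 := by ring
        rw [this] at h
        norm_num at h
        rw [mul_pow]
        linarith
  have hT3 : t ^ 3 ≤ T ^ 3 := (le_abs_self _).trans_eq (abs_pow t 3)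
  have hT9 : 0 ≤ T ^ 9 := by positivity
  have hT30 : 0 ≤ T ^ 3 := by positivity
  have hinv : 1 / L ≤ 1 := by rw [div_le_one hL0]; exact hL
  have hinv0 : 0 < 1 / L := by positivity
  refine h1.trans ((log_one_add_le_cubic hp1).trans ?_)
  -- The constant 12 covers `1/3 + 1/2 + 32/3`, from `t³/3`, the loss in `p²` and the bound on `p³`.
  have key : p - (1 / L) * p ^ 2 / 2 + (1 / L) ^ 2 * p ^ 3 / 3
      ≤ t - (1 + 1 / L) * t ^ 2 / 2 + 12 * (T ^ 3 + T ^ 9) := by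
    have ha : (1 / L) * (t ^ 2 - T ^ 3) ≤ (1 / L) * p ^ 2 := by gcongr
    have hb : (1 / L) * T ^ 3 ≤ T ^ 3 := mul_le_of_le_one_left hT30 hinv
    have hc : (1 / L) ^ 2 * p ^ 3 ≤ 32 * (T ^ 3 + T ^ 9) := by
      calc (1 / L) ^ 2 * p ^ 3 ≤ (1 / L) ^ 2 * (32 * (T ^ 3 + T ^ 9)) := by gcongr
        _ ≤ 32 * (T ^ 3 + T ^ 9) :=
          mul_le_of_le_one_left (by positivity) (pow_le_one₀ hinv0.le hinv)
    have : p = t - t ^ 2 / 2 + t ^ 3 / 3 := hp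
    linarith
  calc p / L - (p / L) ^ 2 / 2 + (p / L) ^ 3 / 3
      = (p - (1 / L) * p ^ 2 / 2 + (1 / L) ^ 2 * p ^ 3 / 3) / L := by field_simp
    _ ≤ _ := by gcongr

/-- A one-sided third order expansion of the reciprocal logarithm, valid for all increments. -/
lemma inv_log_increment_le {L t : ℝ} (hL : 1 ≤ L) (ht : -1 < t) (hLt : 1 ≤ L + Real.log (1 + t)) :
    (L + Real.log (1 + t))⁻¹ - L⁻¹
      ≤ (-t + (1 / 2 + 1 / L) * t ^ 2 + 33 * (|t| ^ 3 + |t| ^ 6)) / L ^ 2 + 64 * |t| ^ 6 := by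
  have hL0 : 0 < L := by linarith
  set s := Real.log (1 + t) with hs
  set T := |t| with hT
  have hT0 : 0 ≤ T := abs_nonneg t
  have hlow : -T ≤ t := neg_abs_le t
  have hup : t ≤ T := le_abs_self t
  -- For large downward jumps the left side is at most 1 and `64 |t|⁶ ≥ 1`. This crude case is the
  -- source of the remainder not divided by `L²`.
  rcases le_or_gt t (-1 / 2) with hsmall | hbig
  · have h1 : (L + s)⁻¹ ≤ 1 := inv_le_one_of_one_le₀ hLt
    have h2 : 0 ≤ L⁻¹ := by positivity
    have hT2 : 1 / 2 ≤ T := by rw [hT, abs_of_neg (by linarith)]; linarith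
    have h3 : 1 ≤ 64 * T ^ 6 := by
      have := pow_le_pow_left₀ (by norm_num) hT2 6
      norm_num at this
      linarith
    have h4 : 0 ≤ (-t + (1 / 2 + 1 / L) * t ^ 2 + 33 * (T ^ 3 + T ^ 6)) / L ^ 2 := by
      have : 0 < -t := by linarith
      positivity
    linarith
  have hpos : 0 < 1 + t := by linarith
  have hst : s ≤ t := by
    have := Real.log_le_sub_one_of_pos hpos
    linarith
  have hsum : t / (1 + t) ≤ s := by
    have := Real.one_sub_inv_le_log_of_pos hpos
    rw [show t / (1 + t) = 1 - (1 + t)⁻¹ by field_simp; ring]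
    exact this
  have hinv2 : (1 + t)⁻¹ ≤ 2 := by
    rw [inv_le_comm₀ hpos two_pos]; linarith
  have hinv0 : 0 < (1 + t)⁻¹ := by positivity
  have hquot : |t / (1 + t)| ≤ 2 * T := by
    rw [div_eq_mul_inv, abs_mul, abs_of_pos hinv0, mul_comm]
    gcongr
  have hsabs : |s| ≤ 2 * T := by
    rw [abs_le]
    constructor
    · linarith [(abs_le.1 hquot).1]
    · linarith
  have hslow : t - t ^ 2 / 2 - 8 / 3 * T ^ 3 ≤ s := by
    -- A lower bound for `log (1+t)` follows from the upper cubic bound at `-t/(1+t)`, because `1 -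
    -- t/(1+t) = 1/(1+t)`.
    have hu : -1 < -(t / (1 + t)) := by
      rw [neg_lt_neg_iff, div_lt_one hpos]; linarith
    have h := log_one_add_le_cubic hu
    have h1 : 1 + -(t / (1 + t)) = (1 + t)⁻¹ := by field_simp; ring
    rw [h1, Real.log_inv, ← hs] at h
    have h2 : -(t / (1 + t)) ^ 3 ≤ 8 * T ^ 3 := by
      calc -(t / (1 + t)) ^ 3 ≤ |t / (1 + t)| ^ 3 := (neg_le_abs _).trans_eq (abs_pow _ 3)
        _ ≤ (2 * T) ^ 3 := by gcongr
        _ = 8 * T ^ 3 := by ring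
    have h3 : -(t / (1 + t)) - (-(t / (1 + t))) ^ 2 / 2
        = -t + t ^ 2 / 2 - t ^ 4 / (2 * (1 + t) ^ 2) := by
      field_simp
      ring
    have h4 : 0 ≤ t ^ 4 / (2 * (1 + t) ^ 2) := by positivity
    have h5 : (-(t / (1 + t))) ^ 3 = -(t / (1 + t)) ^ 3 := by ring
    rw [h3, h5] at h
    linarith
  have hssq : s ^ 2 ≤ t ^ 2 + 6 * T ^ 3 := by
    have hd0 : 0 ≤ t - s := by linarith
    have hd : t - s ≤ 2 * T ^ 2 := by
      have h1 : t - t / (1 + t) = t ^ 2 * (1 + t)⁻¹ := by field_simp; ring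
      have h2 : t ^ 2 * (1 + t)⁻¹ ≤ t ^ 2 * 2 := by gcongr
      rw [hT, sq_abs]
      linarith
    have h3 : -(t + s) ≤ 3 * T := by linarith [(abs_le.1 hsabs).1]
    have h4 : (t - s) * (-(t + s)) ≤ (2 * T ^ 2) * (3 * T) := by
      calc (t - s) * (-(t + s)) ≤ (t - s) * (3 * T) := by gcongr
        _ ≤ (2 * T ^ 2) * (3 * T) := by gcongr
    nlinarith
  have hs3 : -s ^ 3 ≤ 8 * T ^ 3 := by
    calc -s ^ 3 ≤ |s| ^ 3 := (neg_le_abs _).trans_eq (abs_pow _ 3)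
      _ ≤ (2 * T) ^ 3 := by gcongr
      _ = 8 * T ^ 3 := by ring
  have hs4 : s ^ 4 ≤ 16 * (T ^ 3 + T ^ 6) := by
    have h1 : T ^ 4 ≤ T ^ 3 + T ^ 6 := by
      rcases le_total T 1 with h | h
      · have := pow_le_pow_of_le_one hT0 h (show 3 ≤ 4 by norm_num)
        have := pow_nonneg hT0 6
        linarith
      · have := pow_le_pow_right₀ h (show 4 ≤ 6 by norm_num)
        have := pow_nonneg hT0 3
        linarith
    calc s ^ 4 = |s| ^ 4 := by rw [← abs_pow, abs_of_nonneg (by positivity)]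
      _ ≤ (2 * T) ^ 4 := by gcongr
      _ = 16 * T ^ 4 := by ring
      _ ≤ _ := by gcongr
  have hLi0 : 0 < 1 / L := by positivity
  have hLi1 : 1 / L ≤ 1 := by rw [div_le_one hL0]; exact hL
  have hLs0 : 0 < 1 / (L + s) := by positivity
  have hLs1 : 1 / (L + s) ≤ 1 := by rw [div_le_one (by linarith)]; exact hLt
  -- Geometric expansion of `1/(L+s)` with exact fourth-order remainder.
  have hid : (L + s)⁻¹ - L⁻¹ = (-s + (1 / L) * s ^ 2 + (1 / L) ^ 2 * (-s ^ 3)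
      + (1 / L) ^ 2 * (1 / (L + s)) * s ^ 4) / L ^ 2 := by
    have : L + s ≠ 0 := by linarith
    field_simp
    ring
  have hLsq : (1 / L) ^ 2 ≤ 1 := pow_le_one₀ hLi0.le hLi1
  have hT3 : 0 ≤ T ^ 3 := by positivity
  have hT6 : 0 ≤ T ^ 6 := by positivity
  -- The constant 33 covers `8/3 + 6 + 8 + 16`.
  have key : -s + (1 / L) * s ^ 2 + (1 / L) ^ 2 * (-s ^ 3)
      + (1 / L) ^ 2 * (1 / (L + s)) * s ^ 4
      ≤ -t + (1 / 2 + 1 / L) * t ^ 2 + 33 * (T ^ 3 + T ^ 6) := by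
    have ha : (1 / L) * s ^ 2 ≤ (1 / L) * t ^ 2 + 6 * T ^ 3 := by
      calc (1 / L) * s ^ 2 ≤ (1 / L) * (t ^ 2 + 6 * T ^ 3) := by gcongr
        _ = (1 / L) * t ^ 2 + (1 / L) * (6 * T ^ 3) := by ring
        _ ≤ _ := by
          have := mul_le_of_le_one_left (show 0 ≤ 6 * T ^ 3 by positivity) hLi1
          linarith
    have hb : (1 / L) ^ 2 * (-s ^ 3) ≤ 8 * T ^ 3 :=
      (mul_le_mul_of_nonneg_left hs3 (by positivity)).trans
        (mul_le_of_le_one_left (by positivity) hLsq)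
    have hc : (1 / L) ^ 2 * (1 / (L + s)) * s ^ 4 ≤ 16 * (T ^ 3 + T ^ 6) :=
      (mul_le_mul_of_nonneg_left hs4 (by positivity)).trans
        (mul_le_of_le_one_left (by positivity) (mul_le_one₀ hLsq hLs0.le hLs1))
    linarith
  rw [hid]
  have : 0 ≤ 64 * T ^ 6 := by positivity
  have := div_le_div_of_nonneg_right key (sq_nonneg L)
  linarith

/-! ### The noncritical cases -/

section Drift

variable {U : Kernel ℕ ℕ} [IsMarkovKernel U] {μ c : ℝ}

/-- The inequality is just `E[U(x)]/x < 1` for large `x`. The moment bound supplies integrability,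
without which the integral would be the default value 0. -/
lemma superharmonic_id_of_lt_one (hμ1 : μ < 1)
    (hμ : Tendsto (fun x : ℕ => stepMean U x / x) atTop (𝓝 μ)) (hc : 0 < c)
    (hconc : ∀ᶠ x : ℕ in atTop, ∀ ε : ℝ, 0 < ε →
      (U x).real {y : ℕ | ε < |(y : ℝ) / x - μ|}
        ≤ 2 * Real.exp (-(c * ε ^ 2 / (1 + μ + ε)) * x)) :
    ∀ᶠ x : ℕ in atTop, Integrable (fun y : ℕ => (y : ℝ)) (U x) ∧ ∫ y : ℕ, (y : ℝ) ∂(U x) ≤ x := by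
  obtain ⟨C, -, hC⟩ := exists_moment_bound (stepMean_limit_nonneg hμ) hc hconc one_ne_zero
  filter_upwards [hC, hμ.eventually_lt_const hμ1, eventually_ge_atTop 1] with x ⟨hi, _⟩ hlt hx1
  have hx0 : (0 : ℝ) < x := by exact_mod_cast hx1
  refine ⟨?_, ?_⟩
  · simp only [pow_one] at hi
    have h1 : Integrable (fun y : ℕ => (y : ℝ) - μ * x) (U x) :=
      (integrable_norm_iff (measurable_of_countable _).aestronglyMeasurable).1 hi
    exact (h1.add (integrable_const (μ * x))).congr (ae_of_all _ fun y => by simp)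
  · rw [div_lt_one hx0] at hlt
    exact hlt.le

/-- Write `μ = 1 + 2δ` and split at `(1+δ)x`. Above the split the gain over `1/(1+x)` is of order
`1/x`; below it `V ≤ 1` and the fourth moment gives probability `O(x⁻²)`. A second moment would only
give `O(1/x)`. -/
lemma superharmonic_inv_of_one_lt (hμ1 : 1 < μ) (hc : 0 < c)
    (hconc : ∀ᶠ x : ℕ in atTop, ∀ ε : ℝ, 0 < ε →
      (U x).real {y : ℕ | ε < |(y : ℝ) / x - μ|}
        ≤ 2 * Real.exp (-(c * ε ^ 2 / (1 + μ + ε)) * x)) :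
    ∀ᶠ x : ℕ in atTop, Integrable (fun y : ℕ => (1 + (y : ℝ))⁻¹) (U x) ∧
      ∫ y : ℕ, (1 + (y : ℝ))⁻¹ ∂(U x) ≤ (1 + (x : ℝ))⁻¹ := by
  obtain ⟨C, hC0, hC⟩ := exists_moment_bound (by linarith) hc hconc four_ne_zero
  obtain ⟨δ, hδ0, hδ⟩ : ∃ δ : ℝ, 0 < δ ∧ μ = 1 + 2 * δ := ⟨(μ - 1) / 2, by linarith, by ring⟩
  -- This threshold is exactly `C x²/(δx)⁴ ≤ δx/(2x·(2+δ)x)`.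
  have hlarge : ∀ᶠ x : ℕ in atTop, 2 * C * (2 + δ) / δ ^ 5 ≤ x :=
    tendsto_natCast_atTop_atTop.eventually_ge_atTop _
  filter_upwards [hC, hlarge, eventually_ge_atTop 1] with x ⟨hi, hle⟩ hxl hx1
  have hx1' : (1 : ℝ) ≤ x := by exact_mod_cast hx1
  have hx0 : (0 : ℝ) < x := by linarith
  have hVle : ∀ y : ℕ, (1 + (y : ℝ))⁻¹ ≤ 1 := fun y =>
    inv_le_one_of_one_le₀ (by linarith [Nat.cast_nonneg (α := ℝ) y])
  have hV : Integrable (fun y : ℕ => (1 + (y : ℝ))⁻¹) (U x) := by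
    refine Integrable.of_bound (C := 1) (measurable_of_countable _).aestronglyMeasurable
      (ae_of_all _ fun y => ?_)
    rw [Real.norm_of_nonneg (by positivity)]
    exact hVle y
  refine ⟨hV, ?_⟩
  have hpt : ∀ y : ℕ, (1 + (y : ℝ))⁻¹
      ≤ (1 + (1 + δ) * x)⁻¹ + |(y : ℝ) - μ * x| ^ 4 / (δ * x) ^ 4 := by
    intro y
    rcases le_or_gt ((1 + δ) * x) y with hy | hy
    · have h1 : (1 + (y : ℝ))⁻¹ ≤ (1 + (1 + δ) * x)⁻¹ := by gcongr
      have h2 : 0 ≤ |(y : ℝ) - μ * x| ^ 4 / (δ * x) ^ 4 := by positivity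
      linarith
    · have h1 : δ * x ≤ |(y : ℝ) - μ * x| := by
        rw [abs_sub_comm]
        refine le_trans ?_ (le_abs_self _)
        rw [hδ]
        linarith
      have h2 : 1 ≤ |(y : ℝ) - μ * x| ^ 4 / (δ * x) ^ 4 := by
        rw [one_le_div (by positivity)]
        gcongr
      have h3 : 0 ≤ (1 + (1 + δ) * (x : ℝ))⁻¹ := by positivity
      linarith [hVle y]
  have hs4 : √(x : ℝ) ^ 4 = x ^ 2 := by
    rw [show (4 : ℕ) = 2 * 2 from rfl, pow_mul, Real.sq_sqrt hx0.le]
  calc ∫ y : ℕ, (1 + (y : ℝ))⁻¹ ∂(U x)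
      ≤ ∫ y : ℕ, ((1 + (1 + δ) * x)⁻¹ + |(y : ℝ) - μ * x| ^ 4 / (δ * x) ^ 4) ∂(U x) :=
        integral_mono hV ((integrable_const _).add (hi.div_const _)) hpt
    _ = (1 + (1 + δ) * x)⁻¹ + (∫ y : ℕ, |(y : ℝ) - μ * x| ^ 4 ∂(U x)) / (δ * x) ^ 4 := by
        rw [integral_add (integrable_const _) (hi.div_const _), integral_div]
        simp
    _ ≤ (1 + (1 + δ) * x)⁻¹ + C * x ^ 2 / (δ * x) ^ 4 := by
        rw [← hs4]
        gcongr
    _ ≤ (1 + (x : ℝ))⁻¹ := by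
        have h1 : (1 + (x : ℝ))⁻¹ - (1 + (1 + δ) * x)⁻¹
            = δ * x / ((1 + x) * (1 + (1 + δ) * x)) := by
          field_simp
          ring
        have h2 : δ * x / ((2 * x) * ((2 + δ) * x)) ≤ δ * x / ((1 + x) * (1 + (1 + δ) * x)) := by
          gcongr <;> linarith
        have h3 : C * x ^ 2 / (δ * x) ^ 4 ≤ δ * x / ((2 * x) * ((2 + δ) * x)) := by
          rw [div_le_iff₀ (by positivity)] at hxl
          rw [div_le_div_iff₀ (by positivity) (by positivity)]
          have := mul_le_mul_of_nonneg_right hxl (by positivity : (0 : ℝ) ≤ x ^ 4)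
          nlinarith
        linarith

/-! ### The critical case -/

lemma exists_relative_moment_bound (hc : 0 < c)
    (hconc : ∀ᶠ x : ℕ in atTop, ∀ ε : ℝ, 0 < ε →
      (U x).real {y : ℕ | ε < |(y : ℝ) / x - 1|}
        ≤ 2 * Real.exp (-(c * ε ^ 2 / (1 + 1 + ε)) * x)) {k : ℕ} (hk : k ≠ 0) :
    ∃ C : ℝ, 0 ≤ C ∧ ∀ᶠ x : ℕ in atTop,
      Integrable (fun y : ℕ => |((y : ℝ) - x) / (x + 3)| ^ k) (U x) ∧
      ∫ y : ℕ, |((y : ℝ) - x) / (x + 3)| ^ k ∂(U x) ≤ C * (1 / √x) ^ k := by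
  obtain ⟨C, hC0, hC⟩ := exists_moment_bound zero_le_one hc hconc hk
  refine ⟨C, hC0, ?_⟩
  filter_upwards [hC, eventually_ge_atTop 1] with x ⟨hi, hle⟩ hx1
  have hx0 : (0 : ℝ) < x := by exact_mod_cast hx1
  have hs0 : 0 < √(x : ℝ) := Real.sqrt_pos.2 hx0
  have heq : ∀ y : ℕ, |((y : ℝ) - x) / (x + 3)| ^ k = |(y : ℝ) - 1 * x| ^ k / (x + 3) ^ k := by
    intro y
    rw [abs_div, div_pow, one_mul, abs_of_pos (by positivity : (0 : ℝ) < x + 3)]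
  simp_rw [heq]
  refine ⟨hi.div_const _, ?_⟩
  rw [integral_div, div_le_iff₀ (by positivity)]
  refine hle.trans ?_
  rw [mul_assoc, ← mul_pow]
  gcongr
  rw [div_mul_eq_mul_div, one_mul, le_div_iff₀ hs0, Real.mul_self_sqrt hx0.le]
  linarith

/-- The relative increments `(U x - x) / (x + 3)` of a critical chain: moments and centring. -/
structure RelativeMoments (U : Kernel ℕ ℕ) (C : ℝ) (x : ℕ) : Prop where
  integrable : Integrable (fun y : ℕ => ((y : ℝ) - x) / (x + 3)) (U x)
  integrable_pow : ∀ k ∈ ({3, 6, 9} : Finset ℕ),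
    Integrable (fun y : ℕ => |((y : ℝ) - x) / (x + 3)| ^ k) (U x)
  integrable_sq : Integrable (fun y : ℕ => (((y : ℝ) - x) / (x + 3)) ^ 2) (U x)
  integral : ∫ y : ℕ, ((y : ℝ) - x) / (x + 3) ∂(U x) = drift U 1 x / (x + 3)
  integral_sq : ∫ y : ℕ, (((y : ℝ) - x) / (x + 3)) ^ 2 ∂(U x)
    = x * diffusion U 1 x / (x + 3) ^ 2
  integral_pow_le : ∀ k ∈ ({3, 6, 9} : Finset ℕ),
    ∫ y : ℕ, |((y : ℝ) - x) / (x + 3)| ^ k ∂(U x) ≤ C * (1 / √x) ^ k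
  diffusion_nonneg : 0 ≤ diffusion U 1 x
  diffusion_le : diffusion U 1 x ≤ C

/-- The powers 3, 6, 9 are those in the remainders of `log_log_increment_le` and
`inv_log_increment_le`; the first moment serves for integrability. -/
lemma exists_relativeMoments (hc : 0 < c)
    (hconc : ∀ᶠ x : ℕ in atTop, ∀ ε : ℝ, 0 < ε →
      (U x).real {y : ℕ | ε < |(y : ℝ) / x - 1|}
        ≤ 2 * Real.exp (-(c * ε ^ 2 / (1 + 1 + ε)) * x)) :
    ∃ C : ℝ, 0 ≤ C ∧ ∀ᶠ x : ℕ in atTop, RelativeMoments U C x := by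
  obtain ⟨C1, h1, hC1⟩ := exists_relative_moment_bound hc hconc one_ne_zero
  obtain ⟨C2, h2, hC2⟩ := exists_moment_bound zero_le_one hc hconc two_ne_zero
  obtain ⟨C3, h3, hC3⟩ := exists_relative_moment_bound hc hconc three_ne_zero
  obtain ⟨C6, h6, hC6⟩ := exists_relative_moment_bound hc hconc (k := 6) (by norm_num)
  obtain ⟨C9, h9, hC9⟩ := exists_relative_moment_bound hc hconc (k := 9) (by norm_num)
  refine ⟨C2 + C3 + C6 + C9, by positivity, ?_⟩
  filter_upwards [hC1, hC2, hC3, hC6, hC9, eventually_ge_atTop 1] with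
    x ⟨i1, _⟩ ⟨i2, b2⟩ ⟨i3, b3⟩ ⟨i6, b6⟩ ⟨i9, b9⟩ hx1
  have hx0 : (0 : ℝ) < x := by exact_mod_cast hx1
  have hsq : ∀ y : ℕ, (((y : ℝ) - x) / (x + 3)) ^ 2 = ((y : ℝ) - 1 * x) ^ 2 / (x + 3) ^ 2 :=
    fun y => by rw [div_pow, one_mul]
  simp only [sq_abs] at i2 b2
  refine ⟨?_, ?_, ?_, ?_, ?_, ?_, ?_, ?_⟩
  · simp only [pow_one] at i1
    exact (integrable_norm_iff (measurable_of_countable _).aestronglyMeasurable).1 i1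
  · intro k hk
    simp only [Finset.mem_insert, Finset.mem_singleton] at hk
    rcases hk with rfl | rfl | rfl
    exacts [i3, i6, i9]
  · simp_rw [hsq]
    exact i2.div_const _
  · simp only [drift, one_mul]
    rw [integral_div]
  · simp_rw [hsq]
    rw [integral_div, diffusion, mul_div_cancel₀ _ hx0.ne']
  · intro k hk
    simp only [Finset.mem_insert, Finset.mem_singleton] at hk
    have hs : 0 ≤ 1 / √(x : ℝ) := by positivity
    rcases hk with rfl | rfl | rfl
    · refine b3.trans (mul_le_mul_of_nonneg_right (by linarith) (by positivity))
    · refine b6.trans (mul_le_mul_of_nonneg_right (by linarith) (by positivity))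
    · refine b9.trans (mul_le_mul_of_nonneg_right (by linarith) (by positivity))
  · exact div_nonneg (integral_nonneg fun y => sq_nonneg _) hx0.le
  · rw [diffusion, div_le_iff₀ hx0]
    rw [Real.sq_sqrt hx0.le] at b2
    refine b2.trans (mul_le_mul_of_nonneg_right (by linarith) hx0.le)

/-- The shift `3 > e` makes `log log` nonnegative and `1/log` at most 1 on all of `ℕ`, so the
increment bounds apply to every jump. -/
lemma one_le_log_add_three (x : ℕ) : 1 ≤ Real.log ((x : ℝ) + 3) := by
  rw [Real.le_log_iff_exp_le (by positivity)]
  linarith [Real.exp_one_lt_d9, Nat.cast_nonneg (α := ℝ) x]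

lemma relativeIncrement_gt (x y : ℕ) : -1 < ((y : ℝ) - x) / (x + 3) := by
  rw [lt_div_iff₀ (by positivity)]
  linarith [Nat.cast_nonneg (α := ℝ) y]

lemma log_add_three_eq (x y : ℕ) : Real.log ((y : ℝ) + 3)
    = Real.log ((x : ℝ) + 3) + Real.log (1 + ((y : ℝ) - x) / (x + 3)) := by
  rw [← Real.log_mul (by positivity) (by linarith [relativeIncrement_gt x y])]
  congr 1
  field_simp
  ring

lemma RelativeMoments.loglog_integral_le {C : ℝ} {x : ℕ} (h : RelativeMoments U C x) :
    Integrable (fun y : ℕ => Real.log (Real.log ((y : ℝ) + 3))) (U x) ∧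
    ∫ y : ℕ, Real.log (Real.log ((y : ℝ) + 3)) ∂(U x) ≤ Real.log (Real.log ((x : ℝ) + 3)) +
      (drift U 1 x / (x + 3) - (1 + 1 / Real.log (x + 3)) * (x * diffusion U 1 x / (x + 3) ^ 2) / 2
        + 12 * (C * (1 / √x) ^ 3 + C * (1 / √x) ^ 9)) / Real.log (x + 3) := by
  have hL := one_le_log_add_three x
  set L := Real.log ((x : ℝ) + 3) with hLdef
  have i3 := h.integrable_pow 3 (by simp)
  have i9 := h.integrable_pow 9 (by simp)
  have hpt : ∀ y : ℕ, Real.log (Real.log ((y : ℝ) + 3)) ≤ Real.log L +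
      (((y : ℝ) - x) / (x + 3) - (1 + 1 / L) * (((y : ℝ) - x) / (x + 3)) ^ 2 / 2
        + 12 * (|((y : ℝ) - x) / (x + 3)| ^ 3 + |((y : ℝ) - x) / (x + 3)| ^ 9)) / L := by
    intro y
    have hy := log_add_three_eq x y
    have hy1 := one_le_log_add_three y
    have := log_log_increment_le hL (relativeIncrement_gt x y) (by linarith)
    rw [hy]
    linarith
  have iA := h.integrable.sub ((h.integrable_sq.const_mul (1 + 1 / L)).div_const 2)
  have iB := (i3.add i9).const_mul 12
  have iR := (iA.add iB).div_const L
  have iRHS := (integrable_const (μ := U x) (Real.log L)).add iR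
  -- Since `log log (y+3) ≥ 0`, the one-sided majorant also dominates in norm.
  have hV : Integrable (fun y : ℕ => Real.log (Real.log ((y : ℝ) + 3))) (U x) := by
    refine iRHS.mono' (measurable_of_countable _).aestronglyMeasurable (ae_of_all _ fun y => ?_)
    rw [Real.norm_of_nonneg (Real.log_nonneg (one_le_log_add_three y))]
    exact hpt y
  refine ⟨hV, (integral_mono hV iRHS hpt).trans ?_⟩
  have e1 : ∫ y : ℕ, (Real.log L + (((y : ℝ) - x) / (x + 3) - (1 + 1 / L) * (((y : ℝ) - x) / (x + 3)) ^ 2 / 2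
        + 12 * (|((y : ℝ) - x) / (x + 3)| ^ 3 + |((y : ℝ) - x) / (x + 3)| ^ 9)) / L) ∂(U x)
      = Real.log L + (drift U 1 x / (x + 3)
        - (1 + 1 / L) * (x * diffusion U 1 x / (x + 3) ^ 2) / 2
        + 12 * (∫ y : ℕ, |((y : ℝ) - x) / (x + 3)| ^ 3 ∂(U x)
          + ∫ y : ℕ, |((y : ℝ) - x) / (x + 3)| ^ 9 ∂(U x))) / L := by
    have e2 := integral_add (integrable_const (μ := U x) (Real.log L)) iR
    have e3 := integral_add iA iB
    simp only [Pi.add_apply, Pi.sub_apply] at e2 e3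
    rw [e2, integral_div, e3,
      integral_sub h.integrable ((h.integrable_sq.const_mul (1 + 1 / L)).div_const 2),
      h.integral, integral_div, integral_const_mul, integral_const_mul, integral_add i3 i9,
      h.integral_sq]
    simp
  refine e1.le.trans ?_
  have := h.integral_pow_le 3 (by simp)
  have := h.integral_pow_le 9 (by simp)
  gcongr

lemma RelativeMoments.inv_log_integral_le {C : ℝ} {x : ℕ} (h : RelativeMoments U C x) :
    Integrable (fun y : ℕ => (Real.log ((y : ℝ) + 3))⁻¹) (U x) ∧
    ∫ y : ℕ, (Real.log ((y : ℝ) + 3))⁻¹ ∂(U x) ≤ (Real.log ((x : ℝ) + 3))⁻¹ +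
      ((-(drift U 1 x / (x + 3))
        + (1 / 2 + 1 / Real.log (x + 3)) * (x * diffusion U 1 x / (x + 3) ^ 2)
        + 33 * (C * (1 / √x) ^ 3 + C * (1 / √x) ^ 6)) / Real.log (x + 3) ^ 2
        + 64 * (C * (1 / √x) ^ 6)) := by
  have hL := one_le_log_add_three x
  set L := Real.log ((x : ℝ) + 3) with hLdef
  have i3 := h.integrable_pow 3 (by simp)
  have i6 := h.integrable_pow 6 (by simp)
  have hpt : ∀ y : ℕ, (Real.log ((y : ℝ) + 3))⁻¹ ≤ L⁻¹ +
      ((-(((y : ℝ) - x) / (x + 3)) + (1 / 2 + 1 / L) * (((y : ℝ) - x) / (x + 3)) ^ 2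
        + 33 * (|((y : ℝ) - x) / (x + 3)| ^ 3 + |((y : ℝ) - x) / (x + 3)| ^ 6)) / L ^ 2
        + 64 * |((y : ℝ) - x) / (x + 3)| ^ 6) := by
    intro y
    have hy := log_add_three_eq x y
    have hy1 := one_le_log_add_three y
    have := inv_log_increment_le hL (relativeIncrement_gt x y) (by linarith)
    rw [hy]
    linarith
  have iA := h.integrable.neg.add (h.integrable_sq.const_mul (1 / 2 + 1 / L))
  have iB := (i3.add i6).const_mul 33
  have iR := (iA.add iB).div_const (L ^ 2)
  have iS := iR.add (i6.const_mul 64)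
  have iRHS := (integrable_const (μ := U x) L⁻¹).add iS
  have hV : Integrable (fun y : ℕ => (Real.log ((y : ℝ) + 3))⁻¹) (U x) := by
    refine iRHS.mono' (measurable_of_countable _).aestronglyMeasurable (ae_of_all _ fun y => ?_)
    rw [Real.norm_of_nonneg (inv_nonneg.2 (by linarith [one_le_log_add_three y]))]
    exact hpt y
  refine ⟨hV, (integral_mono hV iRHS hpt).trans ?_⟩
  have e1 : ∫ y : ℕ, (L⁻¹ +
      ((-(((y : ℝ) - x) / (x + 3)) + (1 / 2 + 1 / L) * (((y : ℝ) - x) / (x + 3)) ^ 2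
        + 33 * (|((y : ℝ) - x) / (x + 3)| ^ 3 + |((y : ℝ) - x) / (x + 3)| ^ 6)) / L ^ 2
        + 64 * |((y : ℝ) - x) / (x + 3)| ^ 6)) ∂(U x)
      = L⁻¹ + ((-(drift U 1 x / (x + 3))
        + (1 / 2 + 1 / L) * (x * diffusion U 1 x / (x + 3) ^ 2)
        + 33 * (∫ y : ℕ, |((y : ℝ) - x) / (x + 3)| ^ 3 ∂(U x)
          + ∫ y : ℕ, |((y : ℝ) - x) / (x + 3)| ^ 6 ∂(U x))) / L ^ 2
        + 64 * ∫ y : ℕ, |((y : ℝ) - x) / (x + 3)| ^ 6 ∂(U x)) := by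
    have e2 := integral_add (integrable_const (μ := U x) L⁻¹) iS
    have e3 := integral_add iR (i6.const_mul 64)
    have e4 := integral_add iA iB
    have e5 := integral_add h.integrable.neg (h.integrable_sq.const_mul (1 / 2 + 1 / L))
    simp only [Pi.add_apply, Pi.neg_apply] at e2 e3 e4 e5
    rw [e2, e3, integral_div, e4, e5, integral_neg, integral_const_mul, integral_const_mul,
      integral_const_mul, integral_add i3 i6, h.integral, h.integral_sq]
    simp
  refine e1.le.trans ?_
  have := h.integral_pow_le 3 (by simp)
  have := h.integral_pow_le 6 (by simp)
  gcongr

lemma natCast_rpow_neg_half (x : ℕ) : (x : ℝ) ^ (-(1 / 2) : ℝ) = 1 / √x := by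
  rw [Real.rpow_neg (Nat.cast_nonneg x), ← Real.sqrt_eq_rpow, one_div]

/-- Up to the positive factor `1/((x+3)L)`, the bound on the increment is `ρ - (1 + 1/L)(x/(x+3))
ν/2 + O(x^(-1/2))`. Replacing `log (x+3)` by `log x` and `x/(x+3)` by 1 costs `O(1/x)`, and half of
`α ν x^(-1/2)` outweighs all errors. -/
lemma superharmonic_log_log (hc : 0 < c)
    (hconc : ∀ᶠ x : ℕ in atTop, ∀ ε : ℝ, 0 < ε →
      (U x).real {y : ℕ | ε < |(y : ℝ) / x - 1|}
        ≤ 2 * Real.exp (-(c * ε ^ 2 / (1 + 1 + ε)) * x)) {α : ℕ → ℝ}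
    (hα : Tendsto (fun x => α x * diffusion U 1 x) atTop atTop)
    (hθ : ∀ᶠ x : ℕ in atTop,
      driftRatio U 1 x < 1 + 1 / Real.log x - α x * (x : ℝ) ^ (-(1 / 2) : ℝ)) :
    ∀ᶠ x : ℕ in atTop, Integrable (fun y : ℕ => Real.log (Real.log ((y : ℝ) + 3))) (U x) ∧
      ∫ y : ℕ, Real.log (Real.log ((y : ℝ) + 3)) ∂(U x) ≤ Real.log (Real.log ((x : ℝ) + 3)) := by
  obtain ⟨C, hC0, hC⟩ := exists_relativeMoments hc hconc
  filter_upwards [hC, hα.eventually_gt_atTop 0, hα.eventually_ge_atTop (9 * C + 192 * C), hθ,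
    eventually_ge_atTop 3] with x hm hβ0 hβ hθx hx3
  obtain ⟨hV, hle⟩ := hm.loglog_integral_le
  refine ⟨hV, hle.trans ?_⟩
  have hx3' : (3 : ℝ) ≤ x := by exact_mod_cast hx3
  have hx0 : (0 : ℝ) < x := by linarith
  have hL := one_le_log_add_three x
  set L := Real.log ((x : ℝ) + 3) with hLdef
  set ν := diffusion U 1 x with hν
  set ρ := drift U 1 x with hρ
  -- Positivity of `α ν` excludes `ν = 0`, where `driftRatio` would be a division by zero.
  have hν0 : 0 < ν := hm.diffusion_nonneg.lt_of_ne fun h0 => by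
    rw [hν, ← h0, mul_zero] at hβ0
    exact lt_irrefl _ hβ0
  have hνC := hm.diffusion_le
  set l := Real.log (x : ℝ) with hl
  have hl1 : 1 ≤ l := by
    rw [hl, Real.le_log_iff_exp_le hx0]
    linarith [Real.exp_one_lt_d9]
  have hs1 : 1 ≤ √(x : ℝ) := Real.one_le_sqrt.2 (by linarith)
  set r := 1 / √(x : ℝ) with hr
  have hr0 : 0 < r := by positivity
  have hr1 : r ≤ 1 := by rw [hr, div_le_one (by linarith)]; exact hs1
  have hr2 : r ^ 2 * x = 1 := by
    rw [hr, div_pow, Real.sq_sqrt hx0.le]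
    field_simp
  have hρlt : ρ < ν / 2 * (1 + 1 / l) - α x * ν * r / 2 := by
    rw [natCast_rpow_neg_half, driftRatio, div_lt_iff₀ hν0] at hθx
    linarith
  have hinvx : 1 / (x : ℝ) ≤ r := by
    have : 1 / (x : ℝ) = r ^ 2 := by rw [eq_comm, eq_div_iff hx0.ne']; exact hr2
    rw [this, sq]
    exact mul_le_of_le_one_left hr0.le hr1
  have hLl : L ≤ l + 3 / x := by
    have h1 : L = l + Real.log (1 + 3 / x) := by
      rw [hLdef, hl, ← Real.log_mul hx0.ne' (by positivity)]
      congr 1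
      field_simp
    have h2 := Real.log_le_sub_one_of_pos (show 0 < 1 + 3 / (x : ℝ) by positivity)
    linarith
  have hinvL : 1 / l - 3 / x ≤ 1 / L := by
    have h1 : 1 / l - 1 / L = (L - l) / (l * L) := by field_simp
    have h2 : (L - l) / (l * L) ≤ 3 / x := by
      rw [div_le_iff₀ (by positivity)]
      have h3 : 1 ≤ l * L := by nlinarith
      have : 0 ≤ 3 / (x : ℝ) := by positivity
      nlinarith
    linarith
  -- The loss `9/x` is `3/x` from `1/l` against `1/L`, plus `6/x` from the factor `x/(x+3)`, as `1 +
  -- 1/L ≤ 2`.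
  have hfac : 1 + 1 / l - 9 / x ≤ (1 + 1 / L) * (x / (x + 3)) := by
    have h1 : (x : ℝ) / (x + 3) = 1 - 3 / (x + 3) := by field_simp; ring
    have h2 : 3 / ((x : ℝ) + 3) ≤ 3 / x := by gcongr; linarith
    have h3 : 1 / L ≤ 1 := by rw [div_le_one (by linarith)]; exact hL
    have h4 : (1 + 1 / L) * (3 / ((x : ℝ) + 3)) ≤ 2 * (3 / x) := by
      gcongr
      linarith
    rw [h1, mul_sub, mul_one]
    have h5 : (9 : ℝ) / x = 3 * (3 / x) := by ring
    linarith
  have hr9 : r ^ 9 ≤ r ^ 3 := pow_le_pow_of_le_one hr0.le hr1 (by norm_num)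
  have hr3 : r ^ 3 * (x + 3) ≤ 2 * r := by
    have : r ^ 3 * x = r := by linear_combination r * hr2
    have : r ^ 3 * (x + 3) ≤ r ^ 3 * (x + x) := by gcongr
    linarith
  suffices hneg : (ρ / (x + 3) - (1 + 1 / L) * (x * ν / (x + 3) ^ 2) / 2
      + 12 * (C * r ^ 3 + C * r ^ 9)) * (x + 3) ≤ 0 by
    have h1 := nonpos_of_mul_nonpos_left hneg (by positivity : (0 : ℝ) < x + 3)
    have h2 := div_nonpos_of_nonpos_of_nonneg h1 (by linarith : (0 : ℝ) ≤ L)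
    linarith
  have hexp : (ρ / (x + 3) - (1 + 1 / L) * (x * ν / (x + 3) ^ 2) / 2
      + 12 * (C * r ^ 3 + C * r ^ 9)) * (x + 3)
      = ρ - (1 + 1 / L) * (x / (x + 3)) * (ν / 2) + 12 * (C * r ^ 3 + C * r ^ 9) * (x + 3) := by
    field_simp
  rw [hexp]
  have hA : (1 + 1 / l - 9 / x) * (ν / 2) ≤ (1 + 1 / L) * (x / (x + 3)) * (ν / 2) := by gcongr
  have hB : 12 * (C * r ^ 3 + C * r ^ 9) * (x + 3) ≤ 48 * C * r := by
    calc 12 * (C * r ^ 3 + C * r ^ 9) * (x + 3)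
        ≤ 12 * (C * r ^ 3 + C * r ^ 3) * (x + 3) := by gcongr
      _ = 24 * C * (r ^ 3 * (x + 3)) := by ring
      _ ≤ 24 * C * (2 * r) := by gcongr
      _ = 48 * C * r := by ring
  have hD : 9 / (x : ℝ) * (ν / 2) ≤ 9 * r * (C / 2) := by
    have : 9 / (x : ℝ) = 9 * (1 / x) := by ring
    rw [this]
    gcongr
  have hE : (9 * C + 192 * C) * r ≤ α x * ν * r := by gcongr
  have hF : 0 ≤ C * r := by positivity
  linarith

/-- Here `1/L ≤ 1/l` and `x/(x+3) ≤ 1` go the right way, so only the remainders need the margin from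
`α`. -/
lemma superharmonic_inv_log (hc : 0 < c)
    (hconc : ∀ᶠ x : ℕ in atTop, ∀ ε : ℝ, 0 < ε →
      (U x).real {y : ℕ | ε < |(y : ℝ) / x - 1|}
        ≤ 2 * Real.exp (-(c * ε ^ 2 / (1 + 1 + ε)) * x)) {α : ℕ → ℝ}
    (hα : Tendsto (fun x => α x * diffusion U 1 x) atTop atTop)
    (hθ : ∀ᶠ x : ℕ in atTop,
      1 + 2 / Real.log x + α x * (x : ℝ) ^ (-(1 / 2) : ℝ) < driftRatio U 1 x) :
    ∀ᶠ x : ℕ in atTop, Integrable (fun y : ℕ => (Real.log ((y : ℝ) + 3))⁻¹) (U x) ∧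
      ∫ y : ℕ, (Real.log ((y : ℝ) + 3))⁻¹ ∂(U x) ≤ (Real.log ((x : ℝ) + 3))⁻¹ := by
  obtain ⟨C, hC0, hC⟩ := exists_relativeMoments hc hconc
  -- Half of the constant, `2(66 + 64·8)C`, is the total remainder in `hB` below.
  filter_upwards [hC, hα.eventually_gt_atTop 0, hα.eventually_ge_atTop (4 * (66 + 64 * 8) * C), hθ,
    eventually_ge_atTop 3] with x hm hβ0 hβ hθx hx3
  obtain ⟨hV, hle⟩ := hm.inv_log_integral_le
  refine ⟨hV, hle.trans ?_⟩
  have hx3' : (3 : ℝ) ≤ x := by exact_mod_cast hx3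
  have hx0 : (0 : ℝ) < x := by linarith
  have hL := one_le_log_add_three x
  set L := Real.log ((x : ℝ) + 3) with hLdef
  set ν := diffusion U 1 x with hν
  set ρ := drift U 1 x with hρ
  have hν0 : 0 < ν := hm.diffusion_nonneg.lt_of_ne fun h0 => by
    rw [hν, ← h0, mul_zero] at hβ0
    exact lt_irrefl _ hβ0
  set l := Real.log (x : ℝ) with hl
  have hl1 : 1 ≤ l := by
    rw [hl, Real.le_log_iff_exp_le hx0]
    linarith [Real.exp_one_lt_d9]
  have hlL : l ≤ L := Real.log_le_log hx0 (by linarith)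
  have hs1 : 1 ≤ √(x : ℝ) := Real.one_le_sqrt.2 (by linarith)
  set r := 1 / √(x : ℝ) with hr
  have hr0 : 0 < r := by positivity
  have hr1 : r ≤ 1 := by rw [hr, div_le_one (by linarith)]; exact hs1
  have hr2 : r ^ 2 * x = 1 := by
    rw [hr, div_pow, Real.sq_sqrt hx0.le]
    field_simp
  have hρgt : ν / 2 * (1 + 2 / l) + α x * ν * r / 2 < ρ := by
    rw [natCast_rpow_neg_half, driftRatio, lt_div_iff₀ hν0] at hθx
    linarith
  -- Needed for the remainder `64 C r⁶`, which is not divided by `L²`. It comes from `L ≤ 2√(x+3)`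
  -- and `x ≥ 3`.
  have hLsq : L ^ 2 ≤ 8 * x := by
    have h1 := Real.log_le_sub_one_of_pos (show 0 < √((x : ℝ) + 3) by positivity)
    rw [Real.log_sqrt (by positivity)] at h1
    have h2 : L ≤ 2 * √((x : ℝ) + 3) := by linarith
    have h3 : √((x : ℝ) + 3) ^ 2 = x + 3 := Real.sq_sqrt (by positivity)
    have h4 := pow_le_pow_left₀ (by linarith : (0 : ℝ) ≤ L) h2 2
    rw [mul_pow, h3] at h4
    linarith
  have hr6 : r ^ 6 ≤ r ^ 3 := pow_le_pow_of_le_one hr0.le hr1 (by norm_num)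
  have hr6L : r ^ 6 * L ^ 2 ≤ 8 * r ^ 3 := by
    have h1 : r ^ 6 * x = r ^ 4 := by linear_combination r ^ 4 * hr2
    have h2 : r ^ 4 ≤ r ^ 3 := pow_le_pow_of_le_one hr0.le hr1 (by norm_num)
    have h3 : r ^ 6 * L ^ 2 ≤ r ^ 6 * (8 * x) := by gcongr
    linarith
  have hr3 : r ^ 3 * (x + 3) ≤ 2 * r := by
    have : r ^ 3 * x = r := by linear_combination r * hr2
    have : r ^ 3 * (x + 3) ≤ r ^ 3 * (x + x) := by gcongr
    linarith
  suffices hneg : ((-(ρ / (x + 3)) + (1 / 2 + 1 / L) * (x * ν / (x + 3) ^ 2)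
      + 33 * (C * r ^ 3 + C * r ^ 6)) / L ^ 2 + 64 * (C * r ^ 6)) * (L ^ 2 * (x + 3)) ≤ 0 by
    have h1 := nonpos_of_mul_nonpos_left hneg (by positivity : (0 : ℝ) < L ^ 2 * (x + 3))
    linarith
  have hexp : ((-(ρ / (x + 3)) + (1 / 2 + 1 / L) * (x * ν / (x + 3) ^ 2)
      + 33 * (C * r ^ 3 + C * r ^ 6)) / L ^ 2 + 64 * (C * r ^ 6)) * (L ^ 2 * (x + 3))
      = -ρ + (1 / 2 + 1 / L) * ν * (x / (x + 3))
        + (33 * (C * r ^ 3 + C * r ^ 6) + 64 * C * (r ^ 6 * L ^ 2)) * (x + 3) := by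
    field_simp
    ring
  rw [hexp]
  have hA : (1 / 2 + 1 / L) * ν * (x / (x + 3)) ≤ (1 / 2 + 1 / l) * ν := by
    have h1 : (x : ℝ) / (x + 3) ≤ 1 := by rw [div_le_one (by positivity)]; linarith
    calc (1 / 2 + 1 / L) * ν * (x / (x + 3)) ≤ (1 / 2 + 1 / L) * ν :=
          mul_le_of_le_one_right (by positivity) h1
      _ ≤ (1 / 2 + 1 / l) * ν := by gcongr
  have hB : (33 * (C * r ^ 3 + C * r ^ 6) + 64 * C * (r ^ 6 * L ^ 2)) * (x + 3)
      ≤ 2 * (66 + 64 * 8) * C * r := by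
    calc (33 * (C * r ^ 3 + C * r ^ 6) + 64 * C * (r ^ 6 * L ^ 2)) * (x + 3)
        ≤ (33 * (C * r ^ 3 + C * r ^ 3) + 64 * C * (8 * r ^ 3)) * (x + 3) := by gcongr
      _ = (66 + 64 * 8) * C * (r ^ 3 * (x + 3)) := by ring
      _ ≤ (66 + 64 * 8) * C * (2 * r) := by gcongr
      _ = _ := by ring
  have hE : 4 * (66 + 64 * 8) * C * r ≤ α x * ν * r := by gcongr
  have hG : (1 / 2 + 1 / l) * ν = ν / 2 * (1 + 2 / l) := by ring
  linarith

end Drift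

theorem theorem2 {Ω : Type*} [MeasurableSpace Ω] (P : Measure Ω) [IsProbabilityMeasure P]
    (U : Kernel ℕ ℕ) [IsMarkovKernel U] (hirr : Kernel.IsIrreducible Measure.count U)
    (Z : ℕ → Ω → ℕ) (hZ : IsMarkovChain P U Z)
    (μ : ℝ) (hμ : Tendsto (fun x : ℕ => stepMean U x / x) atTop (𝓝 μ))
    (c : ℝ) (hc : 0 < c)
    (hconc : ∀ᶠ x : ℕ in atTop, ∀ ε : ℝ, 0 < ε →
      (U x).real {y : ℕ | ε < |(y : ℝ) / x - μ|}
        ≤ 2 * Real.exp (-(c * ε ^ 2 / (1 + μ + ε)) * x)) :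
    (1 < μ → CanClimbBeforeZero P Z → 0 < P {ω | ∀ n, 0 < Z n ω}) ∧
    (μ < 1 → P {ω | ∃ n, Z n ω = 0} = 1) ∧
    (μ = 1 → ∀ α : ℕ → ℝ, Tendsto (fun x => α x * diffusion U μ x) atTop atTop →
      (∀ᶠ x : ℕ in atTop,
        driftRatio U μ x < 1 + 1 / Real.log x - α x * (x : ℝ) ^ (-(1 / 2) : ℝ)) →
      P {ω | ∃ n, Z n ω = 0} = 1) ∧
    (μ = 1 → ∀ α : ℕ → ℝ, Tendsto (fun x => α x * diffusion U μ x) atTop atTop →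
      (∀ᶠ x : ℕ in atTop,
        1 + 2 / Real.log x + α x * (x : ℝ) ^ (-(1 / 2) : ℝ) < driftRatio U μ x) →
      CanClimbBeforeZero P Z → 0 < P {ω | ∀ n, 0 < Z n ω}) := by
  have hlog : Tendsto (fun x : ℕ => Real.log ((x : ℝ) + 3)) atTop atTop :=
    Real.tendsto_log_atTop.comp (tendsto_atTop_add_const_right _ 3 tendsto_natCast_atTop_atTop)
  refine ⟨fun hμ1 hclimb => ?_, fun hμ1 => ?_, ?_, ?_⟩
  · exact hZ.prob_avoid_zero_pos hclimb (V := fun y => (1 + (y : ℝ))⁻¹) (fun y => by positivity)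
      (tendsto_inv_atTop_zero.comp
        (tendsto_atTop_add_const_left _ 1 tendsto_natCast_atTop_atTop))
      (superharmonic_inv_of_one_lt hμ1 hc hconc)
  · exact hZ.prob_visit_zero_eq_one hirr (fun y => Nat.cast_nonneg y)
      tendsto_natCast_atTop_atTop (superharmonic_id_of_lt_one hμ1 hμ hc hconc)
  · rintro rfl α hα hθ
    exact hZ.prob_visit_zero_eq_one hirr (fun y => Real.log_nonneg (one_le_log_add_three y))
      (Real.tendsto_log_atTop.comp hlog) (superharmonic_log_log hc hconc hα hθ)
  · rintro rfl α hα hθ hclimb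
    exact hZ.prob_avoid_zero_pos hclimb
      (fun y => inv_pos.2 (by linarith [one_le_log_add_three y]))
      (tendsto_inv_atTop_zero.comp hlog) (superharmonic_inv_log hc hconc hα hθ)
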